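/- Let $\beta,b,c\in\mathbb{R}$ with $-\tfrac12<\beta<\tfrac12$ and $b\ge 0$, and let $K_\beta$ denote the principal branch, on the cut plane $\mathbb{C}\setminus(-\infty,0]$ (that is, $z\neq 0$, $|\arg z|<\pi$), of the modified Bessel function of the second kind, $$K_\beta(z)=\frac{\pi}{2}\,\frac{I_{-\beta}(z)-I_\beta(z)}{\sin(\beta\pi)},\qquad I_\nu(z)=\Big(\frac z2\Big)^{\nu}\sum_{k=0}^\infty\frac{(z^2/4)^k}{k!\,\Gamma(\nu+k+1)},$$ where for $\beta=0$ the limit of the quotient as the order tends to $0$ is taken. Consider, with principal powers, the equation $$(2\pi z)^{-1/2}e^{z}K_\beta(z)-bz-c=0,\qquad z\in\mathbb{C}\setminus(-\infty,0].$$ (i) If $b>0$, or if $b=0$ and $c>0$, this equation has exactly one solution, and this solution is real and positive. (ii) Otherwise (that is, if $b=0$ and $c\le 0$) it has no solution. (iii) $K_\beta(z)\neq0$ for every $z\in\mathbb{C}\setminus(-\infty,0]$. -/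

import Mathlib

open Filter Topology

/-- The modified Bessel function of the first kind
`I_ν(z) = (z/2)^ν ∑_{k ≥ 0} (z²/4)^k / (k! Γ(ν+k+1))`, with the principal branch of the power.
At the poles of `Γ` the reciprocal `1/Γ` is `0`, as usual (`Real.Gamma` is `0` there). -/
noncomputable def besselI (ν : ℝ) (z : ℂ) : ℂ :=
  (z / 2) ^ (ν : ℂ) *
    ∑' k : ℕ, (z ^ 2 / 4) ^ k * ((k.factorial : ℂ)⁻¹ * ((Real.Gamma (ν + k + 1) : ℝ) : ℂ)⁻¹)

/-- The quotient `(π/2) (I_{-ν}(z) - I_ν(z)) / sin(νπ)`, meaningful for orders `ν ∉ ℤ`. -/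
noncomputable def besselKQuot (ν : ℝ) (z : ℂ) : ℂ :=
  (Real.pi : ℂ) / 2 * ((besselI (-ν) z - besselI ν z) / ((Real.sin (ν * Real.pi) : ℝ) : ℂ))

open Classical in
/-- The modified Bessel function of the second kind (Macdonald function)
`K_ν(z) = (π/2) (I_{-ν}(z) - I_ν(z)) / sin(νπ)`, principal branch on `ℂ ∖ (-∞, 0]`,
where for integer order `ν` the limiting value of this expression is taken. -/
noncomputable def besselK (ν : ℝ) (z : ℂ) : ℂ :=
  if ∃ n : ℤ, (n : ℝ) = ν then limUnder (𝓝[≠] ν) (fun μ : ℝ => besselKQuot μ z)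
  else besselKQuot ν z

open MeasureTheory Set

/-! Put `a = 1/2 - |β|`, so that `0 < a ≤ 1/2`. Everything rests on the representation, with a
constant `κ > 0`, `(2πz)^(-1/2) e^z K_β(z) = κ z^(-a) ∫₀^∞ e^(-u) u^(a-1) (2z+u)^(a-1) du` on the
cut plane (`exists_scaled_besselK_eq`).

For `z` off the real axis, `z` and `2z+u` have arguments of one sign and of size less than `π`. The
exponents `-a` and `a-1` are negative with sum `-1`, so the argument of `z^(-a) (2z+u)^(a-1)` has
the opposite sign and is still less than `π` in size. Hence the left side has imaginary part of sign
strictly opposite to `Im z` (`im_mul_cpow_mul_tricomiIntegral_im_neg`), whereas `bz + c` has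
imaginary part `b Im z` with `b ≥ 0`. All solutions are therefore real and positive. On the positive
axis the left side is positive, continuous and strictly decreasing from `∞` to `0`, which settles
(i) and (ii). A zero of `K_β` would be a solution for `b = c = 0`, which gives (iii).

To obtain the representation from the series, let `J_a` be `e^(-z)` times the integral. Integration
by parts gives a first-order linear system for `J_a` and `J_{a+1}`. Combined with the recurrences of
the series it makes three Wronskian-type expressions constant, with values read off at `0+`.
Eliminating `J_{a+1}` from them expresses `J_a` by `I_ν` and `I_{-ν}` with `ν = 1/2 - a ≠ 0`
(`besselKQuot_eq_macdonaldIntegral`). Order `0` follows by letting `a` tend to `1/2`. -/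

/-! ### The power series of `I_ν`: convergence, derivative, recurrence -/

/-- The entire function `∑ w ^ k / (k! Γ(μ + k + 1))`. -/
noncomputable def besselSeries (μ : ℝ) (w : ℂ) : ℂ :=
  ∑' k : ℕ, w ^ k * ((k.factorial : ℂ)⁻¹ * ((Real.Gamma (μ + k + 1) : ℝ) : ℂ)⁻¹)

lemma Real.inv_Gamma_eq (x : ℝ) : (Real.Gamma x)⁻¹ = x * (Real.Gamma (x + 1))⁻¹ := by
  rcases eq_or_ne x 0 with rfl | hx
  · simp
  · rw [Real.Gamma_add_one hx, mul_inv, mul_inv_cancel_left₀ hx]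

/-- Once `μ + k + 1 ≥ 1`, passing from `k` to `k + 1` divides `1/Γ` by a number at least `1`; only
finitely many terms remain, whatever the sign of `μ`. -/
lemma exists_abs_inv_Gamma_le (μ : ℝ) : ∃ C : ℝ, ∀ k : ℕ, |(Real.Gamma (μ + k + 1))⁻¹| ≤ C := by
  obtain ⟨N, hN⟩ := exists_nat_ge (-μ)
  refine ⟨∑ k ∈ Finset.range (N + 1), |(Real.Gamma (μ + k + 1))⁻¹|, fun k => ?_⟩
  rcases le_or_gt k N with h | h
  · exact Finset.single_le_sum (f := fun k : ℕ => |(Real.Gamma (μ + k + 1))⁻¹|)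
      (fun _ _ => abs_nonneg _) (Finset.mem_range.2 (by omega))
  · obtain ⟨m, rfl⟩ := Nat.exists_eq_add_of_lt h
    have key : ∀ m : ℕ, |(Real.Gamma (μ + (N + m : ℕ) + 1))⁻¹| ≤ |(Real.Gamma (μ + N + 1))⁻¹| := by
      intro m
      induction m with
      | zero => simp
      | succ m ih =>
        refine le_trans ?_ ih
        rw [Real.inv_Gamma_eq (μ + (N + m : ℕ) + 1), abs_mul]
        have e : μ + ((N + (m + 1) : ℕ) : ℝ) + 1 = μ + ((N + m : ℕ) : ℝ) + 1 + 1 := by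
          push_cast; ring
        rw [e]
        refine le_mul_of_one_le_left (abs_nonneg _) ?_
        refine le_trans ?_ (le_abs_self _)
        push_cast
        have : (0 : ℝ) ≤ m := m.cast_nonneg
        linarith
    refine (key (m + 1)).trans ?_
    exact Finset.single_le_sum (f := fun k : ℕ => |(Real.Gamma (μ + k + 1))⁻¹|)
      (fun _ _ => abs_nonneg _) (Finset.mem_range.2 (by omega))

lemma norm_besselSeries_term_le {μ C : ℝ} (hC : ∀ k : ℕ, |(Real.Gamma (μ + k + 1))⁻¹| ≤ C) (k : ℕ) :
    ‖(k.factorial : ℂ)⁻¹ * ((Real.Gamma (μ + k + 1) : ℝ) : ℂ)⁻¹‖ ≤ C * (k.factorial : ℝ)⁻¹ := by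
  rw [norm_mul, ← Complex.ofReal_inv, Complex.norm_real, Real.norm_eq_abs, norm_inv,
    Complex.norm_natCast, mul_comm]
  exact mul_le_mul_of_nonneg_right (hC k) (by positivity)

lemma summable_besselSeries (μ : ℝ) (w : ℂ) : Summable fun k : ℕ =>
    w ^ k * ((k.factorial : ℂ)⁻¹ * ((Real.Gamma (μ + k + 1) : ℝ) : ℂ)⁻¹) := by
  obtain ⟨C, hC⟩ := exists_abs_inv_Gamma_le μ
  refine Summable.of_norm_bounded ((Real.summable_pow_div_factorial ‖w‖).mul_left C) fun k => ?_
  rw [norm_mul, norm_pow]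
  calc _ ≤ ‖w‖ ^ k * (C * (k.factorial : ℝ)⁻¹) := by
        gcongr; exact norm_besselSeries_term_le hC k
    _ = _ := by ring

/-- Termwise differentiation: `k / k! = 1 / (k-1)!`, and the resulting index shift raises the order
by one. -/
lemma hasDerivAt_besselSeries (μ : ℝ) (w : ℂ) :
    HasDerivAt (besselSeries μ) (besselSeries (μ + 1) w) w := by
  obtain ⟨C, hC⟩ := exists_abs_inv_Gamma_le μ
  have hC0 : 0 ≤ C := (abs_nonneg _).trans (hC 0)
  set R : ℝ := ‖w‖ + 1
  have hu : Summable fun k : ℕ => C * (k * R ^ (k - 1) * (k.factorial : ℝ)⁻¹) := by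
    refine Summable.mul_left C ?_
    rw [← summable_nat_add_iff 1]
    refine (Real.summable_pow_div_factorial R).congr fun k => ?_
    have h1 : ((k : ℝ) + 1) ≠ 0 := by positivity
    have h2 : (k.factorial : ℝ) ≠ 0 := by positivity
    rw [Nat.factorial_succ]; push_cast
    field_simp
  have hd := hasDerivAt_tsum_of_isPreconnected hu Metric.isOpen_ball
    (convex_ball (0 : ℂ) R).isPreconnected
    (g := fun (k : ℕ) (y : ℂ) =>
      y ^ k * ((k.factorial : ℂ)⁻¹ * ((Real.Gamma (μ + k + 1) : ℝ) : ℂ)⁻¹))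
    (g' := fun (k : ℕ) (y : ℂ) =>
      k * y ^ (k - 1) * ((k.factorial : ℂ)⁻¹ * ((Real.Gamma (μ + k + 1) : ℝ) : ℂ)⁻¹))
    (y₀ := w) (y := w)
    (fun k y _ => (hasDerivAt_pow k y).mul_const _)
    (fun k y hy => by
      rw [norm_mul, norm_mul, norm_pow, Complex.norm_natCast]
      have hy' : ‖y‖ ≤ R := by simpa using (mem_ball_zero_iff.1 hy).le
      calc _ ≤ k * R ^ (k - 1) * (C * (k.factorial : ℝ)⁻¹) := by
            gcongr; exact norm_besselSeries_term_le hC k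
        _ = _ := by ring)
    (by simp [R]) (summable_besselSeries μ w) (by simp [R])
  have e : besselSeries (μ + 1) w = ∑' k : ℕ,
      k * w ^ (k - 1) * ((k.factorial : ℂ)⁻¹ * ((Real.Gamma (μ + k + 1) : ℝ) : ℂ)⁻¹) := by
    have hs : Summable fun k : ℕ =>
        k * w ^ (k - 1) * ((k.factorial : ℂ)⁻¹ * ((Real.Gamma (μ + k + 1) : ℝ) : ℂ)⁻¹) := by
      refine Summable.of_norm_bounded hu fun k => ?_
      rw [norm_mul, norm_mul, norm_pow, Complex.norm_natCast]
      calc _ ≤ k * R ^ (k - 1) * (C * (k.factorial : ℝ)⁻¹) := by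
            gcongr
            · simp [R]
            · exact norm_besselSeries_term_le hC k
        _ = _ := by ring
    rw [hs.tsum_eq_zero_add, besselSeries]
    simp only [Nat.cast_zero, zero_mul, zero_add]
    refine tsum_congr fun k => ?_
    have h1 : ((k : ℂ) + 1) ≠ 0 := by exact_mod_cast Nat.succ_ne_zero k
    have h2 : (k.factorial : ℂ) ≠ 0 := by exact_mod_cast k.factorial_ne_zero
    have h3 : μ + ((k + 1 : ℕ) : ℝ) + 1 = μ + 1 + k + 1 := by push_cast; ring
    rw [h3, Nat.factorial_succ]
    push_cast
    field_simp
  rw [e]; exact hd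

/-- Termwise this is `1/Γ(x) = x/Γ(x+1)` at `x = μ + k + 1`, split as `(μ + 1) + k`; the part with
the factor `k` is the shifted series of order `μ + 2`. -/
lemma besselSeries_recurrence (μ : ℝ) (w : ℂ) :
    besselSeries μ w = (μ + 1) * besselSeries (μ + 1) w + w * besselSeries (μ + 2) w := by
  have e : w * besselSeries (μ + 2) w = ∑' k : ℕ,
      k * (w ^ k * ((k.factorial : ℂ)⁻¹ * ((Real.Gamma (μ + 1 + k + 1) : ℝ) : ℂ)⁻¹)) ∧
      Summable fun k : ℕ =>
      k * (w ^ k * ((k.factorial : ℂ)⁻¹ * ((Real.Gamma (μ + 1 + k + 1) : ℝ) : ℂ)⁻¹)) := by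
    have h : ∀ k : ℕ, ((k + 1 : ℕ) : ℂ) * (w ^ (k + 1) * (((k + 1).factorial : ℂ)⁻¹ *
        ((Real.Gamma (μ + 1 + (k + 1 : ℕ) + 1) : ℝ) : ℂ)⁻¹)) =
        w * (w ^ k * ((k.factorial : ℂ)⁻¹ * ((Real.Gamma (μ + 2 + k + 1) : ℝ) : ℂ)⁻¹)) := by
      intro k
      have h1 : ((k : ℂ) + 1) ≠ 0 := by exact_mod_cast Nat.succ_ne_zero k
      have h2 : (k.factorial : ℂ) ≠ 0 := by exact_mod_cast k.factorial_ne_zero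
      have h3 : μ + 1 + ((k + 1 : ℕ) : ℝ) + 1 = μ + 2 + k + 1 := by push_cast; ring
      rw [h3, Nat.factorial_succ]
      push_cast
      rw [pow_succ]
      field_simp
    have hs : Summable fun k : ℕ =>
        k * (w ^ k * ((k.factorial : ℂ)⁻¹ * ((Real.Gamma (μ + 1 + k + 1) : ℝ) : ℂ)⁻¹)) := by
      rw [← summable_nat_add_iff 1]
      refine ((summable_besselSeries (μ + 2) w).mul_left w).congr fun k => (h k).symm
    refine ⟨?_, hs⟩
    rw [hs.tsum_eq_zero_add, besselSeries, ← tsum_mul_left]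
    simp only [Nat.cast_zero, zero_mul, zero_add]
    exact tsum_congr fun k => (h k).symm
  rw [e.1, besselSeries, besselSeries, ← tsum_mul_left,
    ← ((summable_besselSeries (μ + 1) w).mul_left _).tsum_add e.2]
  refine tsum_congr fun k => ?_
  have h := Real.inv_Gamma_eq (μ + k + 1)
  have h' : (((Real.Gamma (μ + k + 1) : ℝ) : ℂ))⁻¹ =
      (μ + k + 1) * ((Real.Gamma (μ + k + 1 + 1) : ℝ) : ℂ)⁻¹ := by exact_mod_cast h
  rw [h', show μ + 1 + k + 1 = μ + (k : ℝ) + 1 + 1 by ring]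
  ring

lemma besselSeries_zero (μ : ℝ) : besselSeries μ 0 = ((Real.Gamma (μ + 1) : ℝ) : ℂ)⁻¹ := by
  rw [besselSeries, tsum_eq_single 0]
  · simp
  · intro k hk; simp [hk]

lemma continuous_besselSeries (μ : ℝ) : Continuous (besselSeries μ) :=
  continuous_iff_continuousAt.2 fun w => (hasDerivAt_besselSeries μ w).continuousAt

lemma besselI_eq (ν : ℝ) (z : ℂ) :
    besselI ν z = (z / 2) ^ (ν : ℂ) * besselSeries ν (z ^ 2 / 4) := rfl

lemma hasDerivAt_besselSeries_sq (μ : ℝ) (z : ℂ) :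
    HasDerivAt (fun z => besselSeries μ (z ^ 2 / 4)) (z / 2 * besselSeries (μ + 1) (z ^ 2 / 4)) z := by
  have h1 : HasDerivAt (fun z : ℂ => z ^ 2 / 4) (z / 2) z :=
    ((hasDerivAt_pow 2 z).div_const 4).congr_deriv (by push_cast; ring)
  exact ((hasDerivAt_besselSeries μ (z ^ 2 / 4)).comp z h1).congr_deriv (mul_comm _ _)

/-! ### The Laplace-type integral: convergence, derivative, contiguous relations -/

/-- The integral `∫₀^∞ e^{-u} u^{p-1} (2z+u)^q du`. -/
noncomputable def tricomiIntegral (p q : ℝ) (z : ℂ) : ℂ :=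
  ∫ u in Ioi (0 : ℝ), ((Real.exp (-u) * u ^ (p - 1) : ℝ) : ℂ) * (2 * z + u) ^ (q : ℂ)

lemma two_mul_add_mem_slitPlane {z : ℂ} (hz : z ∈ Complex.slitPlane) {u : ℝ} (hu : 0 ≤ u) :
    2 * z + u ∈ Complex.slitPlane := by
  rw [Complex.mem_slitPlane_iff] at *
  rcases hz with h | h
  · left; simp; linarith
  · right; simpa using h

/-- If `2z + u` were small, `-u/2` would be close to `z` and so lie in the slit plane. This locally
uniform lower bound supplies the dominating functions for the negative powers of `2z + u`. -/
lemma exists_ball_norm_two_mul_add_ge {z₀ : ℂ} (hz : z₀ ∈ Complex.slitPlane) :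
    ∃ δ > 0, δ ≤ 1 ∧ ∀ z ∈ Metric.ball z₀ δ, z ∈ Complex.slitPlane ∧
      ∀ u : ℝ, 0 ≤ u → δ ≤ ‖2 * z + u‖ := by
  obtain ⟨ε, hε, h⟩ := Metric.isOpen_iff.1 Complex.isOpen_slitPlane z₀ hz
  refine ⟨min (ε / 2) 1, by positivity, min_le_right _ _, fun z hz' => ⟨h ?_, fun u hu => ?_⟩⟩
  · exact Metric.ball_subset_ball ((min_le_left _ _).trans (by linarith)) hz'
  · by_contra! hlt
    have h1 : ‖z - z₀‖ < ε / 2 := (mem_ball_iff_norm.1 hz').trans_le (min_le_left _ _)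
    have h2 : ‖2 * z + u‖ < ε / 2 := hlt.trans_le (min_le_left _ _)
    have h3 : ((-(u / 2) : ℝ) : ℂ) ∈ Complex.slitPlane := by
      apply h
      rw [mem_ball_iff_norm]
      have : (((-(u / 2) : ℝ) : ℂ)) - z₀ = (z - z₀) - (1 / 2 : ℂ) * (2 * z + u) := by
        push_cast; ring
      rw [this]
      refine (norm_sub_le _ _).trans_lt ?_
      rw [norm_mul]
      norm_num
      linarith [norm_nonneg (2 * z + u)]
    rw [Complex.ofReal_mem_slitPlane] at h3
    linarith

lemma norm_cpow_le_of_le_one {w : ℂ} {δ M q : ℝ} (hδ : 0 < δ) (h : δ ≤ ‖w‖) (hM : ‖w‖ ≤ M)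
    (hq : q ≤ 1) : ‖w ^ (q : ℂ)‖ ≤ δ ^ (q - 1) * M := by
  have hw : 0 < ‖w‖ := hδ.trans_le h
  rw [Complex.norm_cpow_real]
  calc ‖w‖ ^ q = ‖w‖ ^ (q - 1) * ‖w‖ := by rw [← Real.rpow_add_one hw.ne']; ring_nf
    _ ≤ δ ^ (q - 1) * M := by
      exact mul_le_mul (Real.rpow_le_rpow_of_nonpos hδ h (by linarith)) hM (norm_nonneg _)
        (by positivity)


lemma integrableOn_exp_mul_rpow {p : ℝ} (hp : 0 < p) :
    IntegrableOn (fun u : ℝ => Real.exp (-u) * u ^ (p - 1)) (Ioi 0) :=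
  Real.GammaIntegral_convergent hp

lemma integrableOn_exp_mul_rpow_mul_add {p : ℝ} (hp : 0 < p) (C : ℝ) :
    IntegrableOn (fun u : ℝ => Real.exp (-u) * u ^ (p - 1) * (C + u)) (Ioi 0) := by
  refine IntegrableOn.congr_fun (((integrableOn_exp_mul_rpow hp).const_mul C).add
    (integrableOn_exp_mul_rpow (p := p + 1) (by linarith))) (fun u hu => ?_) measurableSet_Ioi
  have hu' : u ≠ 0 := (mem_Ioi.1 hu).ne'
  simp only [Pi.add_apply]
  rw [show p + 1 - 1 = p - 1 + 1 by ring, Real.rpow_add_one hu']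
  ring

lemma continuousOn_tricomi_integrand (p q : ℝ) {z : ℂ} (hz : z ∈ Complex.slitPlane) :
    ContinuousOn (fun u : ℝ => ((Real.exp (-u) * u ^ (p - 1) : ℝ) : ℂ) * (2 * z + u) ^ (q : ℂ))
      (Ioi 0) := by
  refine ContinuousOn.mul ?_ ?_
  · refine Complex.continuous_ofReal.comp_continuousOn ?_
    refine (Real.continuous_exp.comp continuous_neg).continuousOn.mul ?_
    exact continuousOn_id.rpow_const fun u hu => Or.inl (mem_Ioi.1 hu).ne'
  · refine ContinuousOn.cpow (by fun_prop) continuousOn_const fun u hu => ?_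
    exact two_mul_add_mem_slitPlane hz (mem_Ioi.1 hu).le

lemma aestronglyMeasurable_tricomi_integrand (p q : ℝ) {z : ℂ} (hz : z ∈ Complex.slitPlane) :
    AEStronglyMeasurable (fun u : ℝ =>
      ((Real.exp (-u) * u ^ (p - 1) : ℝ) : ℂ) * (2 * z + u) ^ (q : ℂ))
      (volume.restrict (Ioi 0)) :=
  (continuousOn_tricomi_integrand p q hz).aestronglyMeasurable measurableSet_Ioi

lemma norm_exp_mul_rpow (p : ℝ) {u : ℝ} (hu : 0 < u) :
    ‖((Real.exp (-u) * u ^ (p - 1) : ℝ) : ℂ)‖ = Real.exp (-u) * u ^ (p - 1) := by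
  rw [Complex.norm_real, Real.norm_of_nonneg (by positivity)]

lemma norm_two_mul_add_le (z : ℂ) {u : ℝ} (hu : 0 < u) : ‖2 * z + u‖ ≤ 2 * ‖z‖ + u := by
  refine (norm_add_le _ _).trans ?_
  rw [Complex.norm_real, Real.norm_of_nonneg hu.le, norm_mul]
  norm_num

lemma integrableOn_tricomi_integrand {p q : ℝ} (hp : 0 < p) (hq : q ≤ 1) {z : ℂ}
    (hz : z ∈ Complex.slitPlane) :
    IntegrableOn (fun u : ℝ => ((Real.exp (-u) * u ^ (p - 1) : ℝ) : ℂ) * (2 * z + u) ^ (q : ℂ))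
      (Ioi 0) := by
  obtain ⟨δ, hδ, -, h⟩ := exists_ball_norm_two_mul_add_ge hz
  refine Integrable.mono' ((integrableOn_exp_mul_rpow_mul_add hp (2 * ‖z‖)).const_mul (δ ^ (q - 1)))
    (aestronglyMeasurable_tricomi_integrand p q hz) ?_
  filter_upwards [ae_restrict_mem measurableSet_Ioi] with u hu
  have hu' : 0 < u := hu
  rw [norm_mul, norm_exp_mul_rpow p hu']
  calc _ ≤ Real.exp (-u) * u ^ (p - 1) * (δ ^ (q - 1) * (2 * ‖z‖ + u)) := by
        gcongr
        exact norm_cpow_le_of_le_one hδ ((h z (Metric.mem_ball_self hδ)).2 u hu'.le)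
          (norm_two_mul_add_le z hu') hq
    _ = _ := by ring

lemma hasDerivAt_tricomiIntegral {p q : ℝ} (hp : 0 < p) (hq : q ≤ 1) {z : ℂ}
    (hz : z ∈ Complex.slitPlane) :
    HasDerivAt (tricomiIntegral p q) (2 * q * tricomiIntegral p (q - 1) z) z := by
  obtain ⟨δ, hδ, -, h⟩ := exists_ball_norm_two_mul_add_ge hz
  have key := hasDerivAt_integral_of_dominated_loc_of_deriv_le (μ := volume.restrict (Ioi (0 : ℝ)))
    (F := fun (z : ℂ) (u : ℝ) =>
      ((Real.exp (-u) * u ^ (p - 1) : ℝ) : ℂ) * (2 * z + u) ^ (q : ℂ))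
    (F' := fun (z : ℂ) (u : ℝ) => 2 * q *
      (((Real.exp (-u) * u ^ (p - 1) : ℝ) : ℂ) * (2 * z + u) ^ ((q - 1 : ℝ) : ℂ)))
    (bound := fun u => ‖(2 * q : ℂ)‖ * δ ^ (q - 1) * (Real.exp (-u) * u ^ (p - 1)))
    (Metric.ball_mem_nhds z hδ)
    (by
      filter_upwards [Complex.isOpen_slitPlane.mem_nhds hz] with y hy
      exact aestronglyMeasurable_tricomi_integrand p q hy)
    (integrableOn_tricomi_integrand hp hq hz)
    ((aestronglyMeasurable_tricomi_integrand p (q - 1) hz).const_mul _)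
    (by
      filter_upwards [ae_restrict_mem measurableSet_Ioi] with u hu y hy
      have hu' : 0 < u := hu
      calc _ = ‖(2 * q : ℂ)‖ * (Real.exp (-u) * u ^ (p - 1)) * ‖2 * y + u‖ ^ (q - 1) := by
            rw [norm_mul, norm_mul (Complex.ofReal _), norm_exp_mul_rpow p hu',
              Complex.norm_cpow_real]; ring
        _ ≤ ‖(2 * q : ℂ)‖ * (Real.exp (-u) * u ^ (p - 1)) * δ ^ (q - 1) := by
            gcongr ?_ * ?_ * ?_
            exact Real.rpow_le_rpow_of_nonpos hδ ((h y hy).2 u hu'.le) (by linarith)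
        _ = _ := by ring)
    ((integrableOn_exp_mul_rpow hp).const_mul _)
    (by
      filter_upwards [ae_restrict_mem measurableSet_Ioi] with u hu y hy
      have hu' : 0 < u := hu
      have h1 : HasDerivAt (fun y : ℂ => 2 * y + u) 2 y := by
        simpa using ((hasDerivAt_id y).const_mul 2).add_const (u : ℂ)
      have h2 := (h1.cpow_const (c := (q : ℂ))
        (two_mul_add_mem_slitPlane (h y hy).1 hu'.le)).const_mul
          (((Real.exp (-u) * u ^ (p - 1) : ℝ) : ℂ))
      exact h2.congr_deriv (by push_cast; ring))
  have e := key.2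
  rw [integral_const_mul] at e
  exact e

/-- Under the integral this is `u + 2z = 2z + u`, one factor absorbed in either power. -/
lemma tricomiIntegral_succ_add {p q : ℝ} (hp : 0 < p) (hq : q ≤ 1) {z : ℂ}
    (hz : z ∈ Complex.slitPlane) :
    tricomiIntegral (p + 1) q z + 2 * z * tricomiIntegral p q z = tricomiIntegral p (q + 1) z := by
  simp only [tricomiIntegral]
  rw [← integral_const_mul, ← integral_add
    (integrableOn_tricomi_integrand (by linarith) hq hz)
    ((integrableOn_tricomi_integrand hp hq hz).const_mul _)]
  refine setIntegral_congr_fun measurableSet_Ioi fun u hu => ?_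
  have hu' : 0 < u := hu
  have h0 := Complex.slitPlane_ne_zero (two_mul_add_mem_slitPlane hz hu'.le)
  have e : u ^ (p + 1 - 1) = u ^ (p - 1) * u := by
    rw [show p + 1 - 1 = p - 1 + 1 by ring, Real.rpow_add_one hu'.ne']
  simp only [e]
  push_cast
  rw [Complex.cpow_add _ _ h0, Complex.cpow_one]
  ring

/-- The derivative of `e^(-u) u^p (2z+u)^q` integrates to `0`: the function vanishes at `0` since `p
> 0`, and at `∞` since it and its derivative are integrable. -/
lemma tricomiIntegral_by_parts {p q : ℝ} (hp : 0 < p) (hq : q ≤ 1) {z : ℂ}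
    (hz : z ∈ Complex.slitPlane) :
    p * tricomiIntegral p q z + q * tricomiIntegral (p + 1) (q - 1) z
      = tricomiIntegral (p + 1) q z := by
  set f : ℝ → ℂ := fun u =>
    ((Real.exp (-u) * u ^ (p + 1 - 1) : ℝ) : ℂ) * (2 * z + u) ^ (q : ℂ) with hf
  have i1 := integrableOn_tricomi_integrand hp hq hz
  have i2 := integrableOn_tricomi_integrand (p := p + 1) (q := q - 1) (by linarith) (by linarith) hz
  have i3 := integrableOn_tricomi_integrand (p := p + 1) (by linarith) hq hz
  have hi := ((i1.const_mul (p : ℂ)).add (i2.const_mul (q : ℂ))).sub i3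
  have hcont : ContinuousWithinAt f (Ici 0) 0 := by
    refine ContinuousWithinAt.mul ?_ ?_
    · refine (Complex.continuous_ofReal.continuousAt).comp_continuousWithinAt ?_
      refine ContinuousWithinAt.mul (by fun_prop) ?_
      exact (Real.continuousAt_rpow_const 0 _ (Or.inr (by linarith))).continuousWithinAt
    · refine ContinuousWithinAt.cpow (by fun_prop) continuousWithinAt_const ?_
      exact two_mul_add_mem_slitPlane hz le_rfl
  have hderiv : ∀ u ∈ Ioi (0 : ℝ), HasDerivAt f _ u := fun u hu => by
    have hu' : 0 < u := hu
    have h1 : HasDerivAt (fun y : ℂ => 2 * z + y) 1 u := (hasDerivAt_id _).const_add _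
    have h2 := (h1.cpow_const (c := (q : ℂ))
      (two_mul_add_mem_slitPlane hz hu'.le)).comp_ofReal
    have h3 : HasDerivAt (fun u : ℝ => Real.exp (-u) * u ^ (p + 1 - 1))
        (p * (Real.exp (-u) * u ^ (p - 1)) - Real.exp (-u) * u ^ (p + 1 - 1)) u := by
      have := ((hasDerivAt_neg u).exp).mul
        (Real.hasDerivAt_rpow_const (x := u) (p := p + 1 - 1) (Or.inl hu'.ne'))
      refine this.congr_deriv ?_
      rw [show p + 1 - 1 = p by ring]
      ring
    have h4 := h3.ofReal_comp.mul h2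
    refine (h4.congr_deriv ?_ : HasDerivAt f
      ((p : ℂ) * (((Real.exp (-u) * u ^ (p - 1) : ℝ) : ℂ) * (2 * z + u) ^ (q : ℂ)) +
        (q : ℂ) * (((Real.exp (-u) * u ^ (p + 1 - 1) : ℝ) : ℂ) * (2 * z + u) ^ ((q - 1 : ℝ) : ℂ)) -
        ((Real.exp (-u) * u ^ (p + 1 - 1) : ℝ) : ℂ) * (2 * z + u) ^ (q : ℂ)) u)
    push_cast
    ring
  have hlim := tendsto_zero_of_hasDerivAt_of_integrableOn_Ioi hderiv hi i3
  have key := integral_Ioi_of_hasDerivAt_of_tendsto hcont hderiv hi hlim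
  have f0 : f 0 = 0 := by
    simp only [hf, add_sub_cancel_right, Real.zero_rpow hp.ne']
    simp
  rw [f0, integral_sub (by exact (i1.const_mul _).add (i2.const_mul _)) i3,
    integral_add (i1.const_mul _) (i2.const_mul _), integral_const_mul, integral_const_mul] at key
  simp only [tricomiIntegral]
  linear_combination key

/-! ### The first-order system for `J_a` and `J_{a+1}` -/

/-- The function `e^{-z} ∫₀^∞ e^{-u} u^{a-1} (2z+u)^{a-1} du`. -/
noncomputable def macdonaldIntegral (a : ℝ) (z : ℂ) : ℂ :=
  Complex.exp (-z) * tricomiIntegral a (a - 1) z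

lemma hasDerivAt_macdonaldIntegral_succ {a : ℝ} (ha : 0 < a) (ha1 : a ≤ 1) {z : ℂ}
    (hz : z ∈ Complex.slitPlane) :
    HasDerivAt (macdonaldIntegral (a + 1)) (-(2 * a * z * macdonaldIntegral a z)) z := by
  have h1 := (hasDerivAt_tricomiIntegral (p := a + 1) (q := a) (by linarith) ha1 hz)
  have h2 := ((hasDerivAt_neg z).cexp).mul h1
  have e : macdonaldIntegral (a + 1) = fun z => Complex.exp (-z) * tricomiIntegral (a + 1) a z := by
    funext z; simp [macdonaldIntegral]
  rw [e]
  refine h2.congr_deriv ?_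
  have r1 := tricomiIntegral_by_parts ha ha1 hz
  have r2 := tricomiIntegral_succ_add (q := a - 1) ha (by linarith) hz
  rw [sub_add_cancel] at r2
  simp only [macdonaldIntegral]
  linear_combination Complex.exp (-z) * (r1 + a * r2)

/-- With `hasDerivAt_macdonaldIntegral_succ` this closes the system: no integrals beyond `J_a` and
`J_{a+1}` occur. The contiguous relations eliminate the others. -/
lemma hasDerivAt_macdonaldIntegral {a : ℝ} (ha : 0 < a) (ha1 : a ≤ 1) {z : ℂ}
    (hz : z ∈ Complex.slitPlane) :
    HasDerivAt (macdonaldIntegral a)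
      (-(macdonaldIntegral (a + 1) z / (2 * a) + (1 - 2 * a) * macdonaldIntegral a z) / z) z := by
  have h1 := (hasDerivAt_tricomiIntegral (p := a) (q := a - 1) ha (by linarith) hz)
  have h2 := ((hasDerivAt_neg z).cexp).mul h1
  refine h2.congr_deriv ?_
  have r1 := tricomiIntegral_by_parts ha ha1 hz
  have r2 := tricomiIntegral_by_parts (q := a - 1) ha (by linarith) hz
  have r3 := tricomiIntegral_succ_add (q := a - 1) ha (by linarith) hz
  have r4 := tricomiIntegral_succ_add (q := a - 1 - 1) ha (by linarith) hz
  rw [sub_add_cancel] at r3 r4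
  have hz0 := Complex.slitPlane_ne_zero hz
  have ha0 : (a : ℂ) ≠ 0 := by exact_mod_cast ha.ne'
  simp only [macdonaldIntegral, add_sub_cancel_right]
  rw [eq_div_iff hz0]
  field_simp
  push_cast at *
  linear_combination -r1 - 2 * a * r2 - a * r3 + 2 * a * (a - 1) * r4

/-! ### Behaviour of the integrals at `0+` -/

lemma tricomiIntegral_ofReal (p q : ℝ) {x : ℝ} (hx : 0 < x) :
    tricomiIntegral p q x =
      ((∫ u in Ioi (0 : ℝ), Real.exp (-u) * u ^ (p - 1) * (2 * x + u) ^ q : ℝ) : ℂ) := by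
  rw [tricomiIntegral, ← integral_complex_ofReal]
  refine setIntegral_congr_fun measurableSet_Ioi fun u hu => ?_
  have hu' : 0 < u := hu
  rw [Complex.ofReal_mul (_ * _), Complex.ofReal_cpow (by positivity)]
  push_cast
  rfl

lemma tendsto_tricomiIntegral_zero {a : ℝ} (ha : 0 < a) (ha1 : a ≤ 1) :
    Tendsto (fun x : ℝ => tricomiIntegral (a + 1) a x) (𝓝[>] 0)
      (𝓝 ((Real.Gamma (2 * a + 1) : ℝ) : ℂ)) := by
  have key : Tendsto (fun x : ℝ => ∫ u in Ioi (0 : ℝ),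
      Real.exp (-u) * u ^ (a + 1 - 1) * (2 * x + u) ^ a) (𝓝[>] 0)
      (𝓝 (∫ u in Ioi (0 : ℝ), Real.exp (-u) * u ^ (2 * a + 1 - 1))) := by
    refine tendsto_integral_filter_of_dominated_convergence
      (fun u => Real.exp (-u) * u ^ (a + 1 - 1) * (2 + u)) ?_ ?_
      (integrableOn_exp_mul_rpow_mul_add (by linarith) 2) ?_
    · exact Eventually.of_forall fun x => by
        refine Measurable.aestronglyMeasurable ?_
        fun_prop
    · have h1 : ∀ᶠ x : ℝ in 𝓝[>] 0, x < 1 := nhdsWithin_le_nhds (eventually_lt_nhds one_pos)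
      filter_upwards [h1, self_mem_nhdsWithin] with x hx hx0
      have hx0' : 0 < x := hx0
      filter_upwards [ae_restrict_mem measurableSet_Ioi] with u hu
      have hu' : 0 < u := hu
      rw [Real.norm_of_nonneg (by positivity)]
      gcongr
      calc (2 * x + u) ^ a ≤ (2 + u) ^ a :=
            Real.rpow_le_rpow (by positivity) (by linarith) ha.le
        _ ≤ (2 + u) ^ (1 : ℝ) := Real.rpow_le_rpow_of_exponent_le (by linarith) ha1
        _ = 2 + u := Real.rpow_one _
    · filter_upwards [ae_restrict_mem measurableSet_Ioi] with u hu
      have hu' : 0 < u := hu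
      have e : Real.exp (-u) * u ^ (2 * a + 1 - 1) =
          Real.exp (-u) * u ^ (a + 1 - 1) * (2 * 0 + u) ^ a := by
        rw [mul_zero, zero_add, mul_assoc, ← Real.rpow_add hu']
        ring_nf
      rw [e]
      refine Tendsto.const_mul _ (Tendsto.mono_left ?_ nhdsWithin_le_nhds)
      refine Tendsto.rpow_const ?_ (Or.inr ha.le)
      have : Continuous fun x : ℝ => 2 * x + u := by fun_prop
      exact this.tendsto 0
  rw [Real.Gamma_eq_integral (by linarith)]
  refine ((Complex.continuous_ofReal.tendsto _).comp key).congr' ?_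
  filter_upwards [self_mem_nhdsWithin] with x hx
  exact (tricomiIntegral_ofReal _ _ hx).symm

lemma integrableOn_rpow_mul_exp_neg_mul {p r : ℝ} (hp : 0 < p) (hr : 0 < r) :
    IntegrableOn (fun t : ℝ => t ^ (p - 1) * Real.exp (-(r * t))) (Ioi 0) := by
  refine Integrable.of_integral_ne_zero ?_
  rw [Real.integral_rpow_mul_exp_neg_mul_Ioi hp hr]
  have := Real.Gamma_pos_of_pos hp
  positivity

lemma lintegral_rpow_mul_exp_neg_mul {p r : ℝ} (hp : 0 < p) (hr : 0 < r) :
    ∫⁻ t in Ioi (0 : ℝ), ENNReal.ofReal (t ^ (p - 1) * Real.exp (-(r * t))) =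
      ENNReal.ofReal ((1 / r) ^ p * Real.Gamma p) := by
  rw [← Real.integral_rpow_mul_exp_neg_mul_Ioi hp hr,
    ofReal_integral_eq_lintegral_ofReal (integrableOn_rpow_mul_exp_neg_mul hp hr)]
  filter_upwards [ae_restrict_mem measurableSet_Ioi] with t ht
  have ht' : 0 < t := ht
  simp only [Pi.zero_apply]
  positivity

/-- Write `Γ(1-a) (2+s)^(a-1)` as `∫ r^(-a) e^(-(2+s)r) dr`, exchange the integrals by Tonelli, and
simplify with the duplication formula. The bound `a < 1/2` is what makes the integral converge at
infinity. Working with `∫⁻` yields integrability along with the value. -/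
lemma lintegral_rpow_mul_two_add_rpow {a : ℝ} (ha : 0 < a) (ha1 : a < 1 / 2) :
    ∫⁻ s in Ioi (0 : ℝ), ENNReal.ofReal (s ^ (a - 1) * (2 + s) ^ (a - 1)) =
      ENNReal.ofReal (Real.Gamma a * Real.Gamma (1 / 2 - a) / (2 * √Real.pi)) := by
  have hG := Real.Gamma_pos_of_pos (show 0 < 1 - a by linarith)
  have hGa := Real.Gamma_pos_of_pos ha
  have hswap := lintegral_lintegral_swap (μ := volume.restrict (Ioi (0 : ℝ)))
    (ν := volume.restrict (Ioi (0 : ℝ)))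
    (f := fun s r => ENNReal.ofReal (s ^ (a - 1) * (r ^ (1 - a - 1) * Real.exp (-((2 + s) * r)))))
    (by refine Measurable.aemeasurable ?_; fun_prop)
  have hl : ∀ s ∈ Ioi (0 : ℝ), ∫⁻ r in Ioi (0 : ℝ),
      ENNReal.ofReal (s ^ (a - 1) * (r ^ (1 - a - 1) * Real.exp (-((2 + s) * r)))) =
      ENNReal.ofReal (Real.Gamma (1 - a)) *
        ENNReal.ofReal (s ^ (a - 1) * (2 + s) ^ (a - 1)) := fun s hs => by
    have hs' : 0 < s := hs
    simp_rw [ENNReal.ofReal_mul (Real.rpow_nonneg hs'.le (a - 1))]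
    rw [lintegral_const_mul' _ _ ENNReal.ofReal_ne_top,
      lintegral_rpow_mul_exp_neg_mul (by linarith) (by positivity),
      ← ENNReal.ofReal_mul (by positivity), ← ENNReal.ofReal_mul (by positivity),
      ← ENNReal.ofReal_mul (by positivity)]
    congr 1
    rw [one_div, Real.inv_rpow (by positivity), ← Real.rpow_neg (by positivity), neg_sub]
    ring
  have hr : ∀ r ∈ Ioi (0 : ℝ), ∫⁻ s in Ioi (0 : ℝ),
      ENNReal.ofReal (s ^ (a - 1) * (r ^ (1 - a - 1) * Real.exp (-((2 + s) * r)))) =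
      ENNReal.ofReal (Real.Gamma a) *
        ENNReal.ofReal (r ^ (1 - 2 * a - 1) * Real.exp (-(2 * r))) := fun r hr => by
    have hr' : 0 < r := hr
    have e : ∀ s : ℝ, s ^ (a - 1) * (r ^ (1 - a - 1) * Real.exp (-((2 + s) * r))) =
        (r ^ (1 - a - 1) * Real.exp (-(2 * r))) * (s ^ (a - 1) * Real.exp (-(r * s))) := by
      intro s
      rw [show -((2 + s) * r) = -(2 * r) + -(r * s) by ring, Real.exp_add]
      ring
    simp_rw [e, ENNReal.ofReal_mul (show 0 ≤ r ^ (1 - a - 1) * Real.exp (-(2 * r)) by positivity)]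
    rw [lintegral_const_mul' _ _ ENNReal.ofReal_ne_top,
      lintegral_rpow_mul_exp_neg_mul ha hr', ← ENNReal.ofReal_mul (by positivity),
      ← ENNReal.ofReal_mul (by positivity)]
    congr 1
    rw [one_div, Real.inv_rpow (by positivity), ← Real.rpow_neg (by positivity),
      show 1 - 2 * a - 1 = (1 - a - 1) + -a by ring, Real.rpow_add hr']
    ring
  rw [setLIntegral_congr_fun measurableSet_Ioi hl, setLIntegral_congr_fun measurableSet_Ioi hr,
    lintegral_const_mul' _ _ ENNReal.ofReal_ne_top, lintegral_const_mul' _ _ ENNReal.ofReal_ne_top,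
    lintegral_rpow_mul_exp_neg_mul (by linarith) two_pos] at hswap
  refine (ENNReal.mul_right_inj (a := ENNReal.ofReal (Real.Gamma (1 - a))) (by simpa using hG)
    ENNReal.ofReal_ne_top).1 ?_
  rw [hswap, ← ENNReal.ofReal_mul (by positivity), ← ENNReal.ofReal_mul (by positivity)]
  congr 1
  have dup := Real.Gamma_mul_Gamma_add_half (1 / 2 - a)
  rw [show 1 / 2 - a + 1 / 2 = 1 - a by ring, show 2 * (1 / 2 - a) = 1 - 2 * a by ring,
    show 1 - (1 - 2 * a) = -(1 - 2 * a) + 1 by ring, Real.rpow_add_one two_ne_zero] at dup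
  have hpi : 0 < √Real.pi := Real.sqrt_pos.2 Real.pi_pos
  have e : (1 / 2 : ℝ) ^ (1 - 2 * a) = 2 ^ (-(1 - 2 * a)) := by
    rw [one_div, Real.inv_rpow two_pos.le, ← Real.rpow_neg two_pos.le]
  rw [e, mul_div_assoc', eq_div_iff (by positivity)]
  linear_combination (-Real.Gamma a) * dup

lemma integrableOn_rpow_mul_two_add_rpow {a : ℝ} (ha : 0 < a) (ha1 : a < 1 / 2) :
    IntegrableOn (fun s : ℝ => s ^ (a - 1) * (2 + s) ^ (a - 1)) (Ioi 0) := by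
  refine ⟨Measurable.aestronglyMeasurable (by fun_prop), ?_⟩
  rw [hasFiniteIntegral_iff_ofReal, lintegral_rpow_mul_two_add_rpow ha ha1]
  · exact ENNReal.ofReal_lt_top
  · filter_upwards [ae_restrict_mem measurableSet_Ioi] with t ht
    have ht' : 0 < t := ht
    simp only [Pi.zero_apply]
    positivity

lemma integral_rpow_mul_two_add_rpow {a : ℝ} (ha : 0 < a) (ha1 : a < 1 / 2) :
    ∫ s in Ioi (0 : ℝ), s ^ (a - 1) * (2 + s) ^ (a - 1) =
      Real.Gamma a * Real.Gamma (1 / 2 - a) / (2 * √Real.pi) := by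
  have hG := Real.Gamma_pos_of_pos (show 0 < 1 / 2 - a by linarith)
  have hGa := Real.Gamma_pos_of_pos ha
  rw [integral_eq_lintegral_of_nonneg_ae, lintegral_rpow_mul_two_add_rpow ha ha1,
    ENNReal.toReal_ofReal (by positivity)]
  · filter_upwards [ae_restrict_mem measurableSet_Ioi] with t ht
    have ht' : 0 < t := ht
    simp only [Pi.zero_apply]
    positivity
  · exact Measurable.aestronglyMeasurable (by fun_prop)

/-- The substitution `u = x s` pulls out `x^(2a-1)` and leaves the limiting integrand times `e^(-xs)
≤ 1`, so dominated convergence applies. -/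
lemma tendsto_rpow_mul_tricomiIntegral_zero {a : ℝ} (ha : 0 < a) (ha1 : a < 1 / 2) :
    Tendsto (fun x : ℝ => ((x ^ (1 - 2 * a) : ℝ) : ℂ) * tricomiIntegral a (a - 1) x) (𝓝[>] 0)
      (𝓝 ((Real.Gamma a * Real.Gamma (1 / 2 - a) / (2 * √Real.pi) : ℝ) : ℂ)) := by
  rw [← integral_rpow_mul_two_add_rpow ha ha1]
  have key : Tendsto (fun x : ℝ => ∫ s in Ioi (0 : ℝ),
      Real.exp (-(x * s)) * (s ^ (a - 1) * (2 + s) ^ (a - 1))) (𝓝[>] 0)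
      (𝓝 (∫ s in Ioi (0 : ℝ), s ^ (a - 1) * (2 + s) ^ (a - 1))) := by
    refine tendsto_integral_filter_of_dominated_convergence
      (fun s => s ^ (a - 1) * (2 + s) ^ (a - 1)) ?_ ?_
      (integrableOn_rpow_mul_two_add_rpow ha ha1) ?_
    · exact Eventually.of_forall fun x => Measurable.aestronglyMeasurable (by fun_prop)
    · filter_upwards [self_mem_nhdsWithin] with x hx
      have hx' : 0 < x := hx
      filter_upwards [ae_restrict_mem measurableSet_Ioi] with u hu
      have hu' : 0 < u := hu
      rw [Real.norm_of_nonneg (by positivity)]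
      refine mul_le_of_le_one_left (by positivity) (Real.exp_le_one_iff.2 ?_)
      have := mul_pos hx' hu'
      linarith
    · refine Eventually.of_forall fun s => Tendsto.mono_left ?_ nhdsWithin_le_nhds
      have : Continuous fun x : ℝ => Real.exp (-(x * s)) * (s ^ (a - 1) * (2 + s) ^ (a - 1)) := by
        fun_prop
      simpa using this.tendsto 0
  refine ((Complex.continuous_ofReal.tendsto _).comp key).congr' ?_
  filter_upwards [self_mem_nhdsWithin] with x hx
  have hx' : 0 < x := hx
  rw [tricomiIntegral_ofReal _ _ hx', ← Complex.ofReal_mul]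
  simp only [Function.comp]
  congr 1
  have hs := integral_comp_mul_left_Ioi
    (fun u : ℝ => Real.exp (-u) * u ^ (a - 1) * (2 * x + u) ^ (a - 1)) 0 hx'
  rw [mul_zero, smul_eq_mul, eq_inv_mul_iff_mul_eq₀ hx'.ne'] at hs
  rw [← hs, ← integral_const_mul, ← integral_const_mul]
  refine setIntegral_congr_fun measurableSet_Ioi fun s hs => ?_
  have hs' : 0 < s := hs
  rw [show 2 * x + x * s = x * (2 + s) by ring, Real.mul_rpow hx'.le hs'.le,
    Real.mul_rpow hx'.le (by positivity)]
  have e : x ^ (1 - 2 * a) * x * x ^ (a - 1) * x ^ (a - 1) = 1 := by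
    rw [← Real.rpow_add_one hx'.ne', ← Real.rpow_add hx', ← Real.rpow_add hx']
    ring_nf
    exact Real.rpow_zero x
  linear_combination (-(Real.exp (-(x * s)) * (s ^ (a - 1) * (2 + s) ^ (a - 1)))) * e

/-! ### Three Wronskian-type constants -/

lemma eqOn_slitPlane_of_deriv_eq_zero {f : ℂ → ℂ} {c : ℂ}
    (hf : ∀ z ∈ Complex.slitPlane, HasDerivAt f 0 z)
    (hc : Tendsto (fun x : ℝ => f x) (𝓝[>] 0) (𝓝 c)) {z : ℂ} (hz : z ∈ Complex.slitPlane) :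
    f z = c := by
  have hconn : IsPreconnected Complex.slitPlane :=
    (Complex.starConvex_one_slitPlane.isPathConnected
      Complex.one_mem_slitPlane).isConnected.isPreconnected
  obtain ⟨d, hd⟩ := Complex.isOpen_slitPlane.exists_is_const_of_deriv_eq_zero hconn
    (fun z hz => (hf z hz).differentiableAt.differentiableWithinAt) (fun z hz => (hf z hz).deriv)
  rw [hd z hz]
  refine tendsto_nhds_unique (Tendsto.congr' ?_ tendsto_const_nhds) hc
  filter_upwards [self_mem_nhdsWithin] with x hx
  exact (hd x (Complex.ofReal_mem_slitPlane.2 hx)).symm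

lemma tendsto_besselSeries_sq_zero (μ : ℝ) :
    Tendsto (fun x : ℝ => besselSeries μ ((x : ℂ) ^ 2 / 4)) (𝓝[>] 0)
      (𝓝 ((Real.Gamma (μ + 1) : ℝ) : ℂ)⁻¹) := by
  have hc : Continuous fun x : ℝ => besselSeries μ ((x : ℂ) ^ 2 / 4) :=
    (continuous_besselSeries μ).comp (by fun_prop)
  have := hc.tendsto 0
  simp only [Complex.ofReal_zero, ne_eq, OfNat.ofNat_ne_zero, not_false_eq_true, zero_pow,
    zero_div, besselSeries_zero] at this
  exact this.mono_left nhdsWithin_le_nhds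

lemma tendsto_ofReal_rpow_zero {r : ℝ} (hr : 0 < r) :
    Tendsto (fun x : ℝ => ((x ^ r : ℝ) : ℂ)) (𝓝[>] 0) (𝓝 0) := by
  have := (Real.continuousAt_rpow_const 0 r (Or.inr hr.le)).tendsto
  rw [Real.zero_rpow hr.ne'] at this
  have h2 := (Complex.continuous_ofReal.tendsto 0).comp (this.mono_left (nhdsWithin_le_nhds (s := Ioi 0)))
  rwa [Complex.ofReal_zero] at h2

lemma tendsto_macdonaldIntegral_succ_zero {a : ℝ} (ha : 0 < a) (ha1 : a ≤ 1) :
    Tendsto (fun x : ℝ => macdonaldIntegral (a + 1) x) (𝓝[>] 0)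
      (𝓝 ((Real.Gamma (2 * a + 1) : ℝ) : ℂ)) := by
  have h : Tendsto (fun x : ℝ => Complex.exp (-x)) (𝓝[>] 0) (𝓝 1) := by
    have : Continuous fun x : ℝ => Complex.exp (-x) := by fun_prop
    simpa using (this.tendsto 0).mono_left (nhdsWithin_le_nhds (s := Ioi 0))
  simpa [macdonaldIntegral] using h.mul (tendsto_tricomiIntegral_zero ha ha1)

lemma tendsto_rpow_mul_macdonaldIntegral_zero {a : ℝ} (ha : 0 < a) (ha1 : a < 1 / 2) :
    Tendsto (fun x : ℝ => ((x ^ (1 - 2 * a) : ℝ) : ℂ) * macdonaldIntegral a x) (𝓝[>] 0)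
      (𝓝 ((Real.Gamma a * Real.Gamma (1 / 2 - a) / (2 * √Real.pi) : ℝ) : ℂ)) := by
  have h : Tendsto (fun x : ℝ => Complex.exp (-x)) (𝓝[>] 0) (𝓝 1) := by
    have : Continuous fun x : ℝ => Complex.exp (-x) := by fun_prop
    simpa using (this.tendsto 0).mono_left (nhdsWithin_le_nhds (s := Ioi 0))
  have := h.mul (tendsto_rpow_mul_tricomiIntegral_zero ha ha1)
  rw [one_mul] at this
  refine this.congr fun x => ?_
  simp only [macdonaldIntegral]
  ring

/-- The Wronskian of `I_ν` and `I_{-ν}` for `ν = 1/2 - a`, stripped of powers of `z`. The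
recurrences cancel its derivative, and the reflection formula evaluates it at `0`. -/
lemma besselSeries_mul_sub_const {a : ℝ} {z : ℂ} (hz : z ∈ Complex.slitPlane) :
    z ^ 2 / 4 * besselSeries (1 / 2 - a) (z ^ 2 / 4) * besselSeries (a + 1 / 2) (z ^ 2 / 4)
      - besselSeries (a - 1 / 2) (z ^ 2 / 4) * besselSeries (-a - 1 / 2) (z ^ 2 / 4) =
    -((Real.cos (Real.pi * a) / Real.pi : ℝ) : ℂ) := by
  refine eqOn_slitPlane_of_deriv_eq_zero (f := fun z => z ^ 2 / 4 *
    besselSeries (1 / 2 - a) (z ^ 2 / 4) * besselSeries (a + 1 / 2) (z ^ 2 / 4)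
      - besselSeries (a - 1 / 2) (z ^ 2 / 4) * besselSeries (-a - 1 / 2) (z ^ 2 / 4))
    (fun z hz => ?_) ?_ hz
  · have h1 : HasDerivAt (fun z : ℂ => z ^ 2 / 4) (z / 2) z :=
      ((hasDerivAt_pow 2 z).div_const 4).congr_deriv (by push_cast; ring)
    refine (((h1.mul (hasDerivAt_besselSeries_sq (1 / 2 - a) z)).mul
      (hasDerivAt_besselSeries_sq (a + 1 / 2) z)).sub
      ((hasDerivAt_besselSeries_sq (a - 1 / 2) z).mul
      (hasDerivAt_besselSeries_sq (-a - 1 / 2) z))).congr_deriv ?_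
    have r1 := besselSeries_recurrence (-a - 1 / 2) (z ^ 2 / 4)
    have r2 := besselSeries_recurrence (a - 1 / 2) (z ^ 2 / 4)
    rw [show -a - 1 / 2 + 1 = 1 / 2 - a by ring, show -a - 1 / 2 + 2 = 1 / 2 - a + 1 by ring] at r1
    rw [show a - 1 / 2 + 1 = a + 1 / 2 by ring, show a - 1 / 2 + 2 = a + 1 / 2 + 1 by ring] at r2
    rw [show -a - 1 / 2 + 1 = 1 / 2 - a by ring, show a - 1 / 2 + 1 = a + 1 / 2 by ring]
    push_cast at r1 r2
    simp only [Pi.mul_apply]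
    rw [r1, r2]
    ring
  · have hx : Tendsto (fun x : ℝ => (x : ℂ) ^ 2 / 4) (𝓝[>] 0) (𝓝 0) := by
      have : Continuous fun x : ℝ => (x : ℂ) ^ 2 / 4 := by fun_prop
      simpa using (this.tendsto 0).mono_left (nhdsWithin_le_nhds (s := Ioi 0))
    have h := ((hx.mul (tendsto_besselSeries_sq_zero (1 / 2 - a))).mul
      (tendsto_besselSeries_sq_zero (a + 1 / 2))).sub
      ((tendsto_besselSeries_sq_zero (a - 1 / 2)).mul (tendsto_besselSeries_sq_zero (-a - 1 / 2)))
    convert h using 2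
    rw [zero_mul, zero_mul, zero_sub]
    congr 1
    have := Real.Gamma_mul_Gamma_one_sub (a + 1 / 2)
    rw [show Real.pi * (a + 1 / 2) = Real.pi * a + Real.pi / 2 by ring, Real.sin_add_pi_div_two]
      at this
    rw [show a - 1 / 2 + 1 = a + 1 / 2 by ring, show -a - 1 / 2 + 1 = 1 - (a + 1 / 2) by ring,
      ← mul_inv, ← Complex.ofReal_mul, this, ← Complex.ofReal_inv, inv_div]

/-- The Wronskian of `J_a` with `I_{-ν}`, `ν = 1/2 - a`. Only the `J_{a+1}` term survives at `0+`;
the duplication formula gives its value. -/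
lemma macdonaldIntegral_besselSeries_const {a : ℝ} (ha : 0 < a) (ha1 : a < 1 / 2) {z : ℂ}
    (hz : z ∈ Complex.slitPlane) :
    z ^ 2 * macdonaldIntegral a z * besselSeries (a + 1 / 2) (z ^ 2 / 4) * a
      + macdonaldIntegral (a + 1) z * besselSeries (a - 1 / 2) (z ^ 2 / 4) =
    ((Real.Gamma a * 2 ^ (2 * a) * a / √Real.pi : ℝ) : ℂ) := by
  have ha0 : (a : ℂ) ≠ 0 := by exact_mod_cast ha.ne'
  refine eqOn_slitPlane_of_deriv_eq_zero (f := fun z => z ^ 2 * macdonaldIntegral a z *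
    besselSeries (a + 1 / 2) (z ^ 2 / 4) * a
      + macdonaldIntegral (a + 1) z * besselSeries (a - 1 / 2) (z ^ 2 / 4))
    (fun z hz => ?_) ?_ hz
  · refine (((((hasDerivAt_pow 2 z).mul (hasDerivAt_macdonaldIntegral ha (by linarith) hz)).mul
      (hasDerivAt_besselSeries_sq (a + 1 / 2) z)).mul_const (a : ℂ)).add
      ((hasDerivAt_macdonaldIntegral_succ ha (by linarith) hz).mul
      (hasDerivAt_besselSeries_sq (a - 1 / 2) z))).congr_deriv ?_
    have r2 := besselSeries_recurrence (a - 1 / 2) (z ^ 2 / 4)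
    rw [show a - 1 / 2 + 1 = a + 1 / 2 by ring, show a - 1 / 2 + 2 = a + 1 / 2 + 1 by ring] at r2
    rw [show a - 1 / 2 + 1 = a + 1 / 2 by ring]
    have hz0 := Complex.slitPlane_ne_zero hz
    push_cast at r2 ⊢
    simp only [Pi.mul_apply]
    rw [r2]
    field_simp
    ring
  -- Split `x² = x^(1+2a) x^(1-2a)`: the second factor keeps `J_a` bounded, the first sends the term
  -- to `0`.
  · have hx : Tendsto (fun x : ℝ => ((x ^ (1 + 2 * a) : ℝ) : ℂ)) (𝓝[>] 0) (𝓝 0) :=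
      tendsto_ofReal_rpow_zero (by linarith)
    have h := (((hx.mul (tendsto_rpow_mul_macdonaldIntegral_zero ha ha1)).mul
      (tendsto_besselSeries_sq_zero (a + 1 / 2))).mul_const (a : ℂ)).add
      ((tendsto_macdonaldIntegral_succ_zero ha (by linarith)).mul
        (tendsto_besselSeries_sq_zero (a - 1 / 2)))
    have e : ((Real.Gamma a * 2 ^ (2 * a) * a / √Real.pi : ℝ) : ℂ) =
        ((Real.Gamma (2 * a + 1) : ℝ) : ℂ) * (((Real.Gamma (a - 1 / 2 + 1)) : ℝ) : ℂ)⁻¹ := by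
      rw [← Complex.ofReal_inv, ← Complex.ofReal_mul]
      congr 1
      have dup := Real.Gamma_mul_Gamma_add_half a
      have hpi : 0 < √Real.pi := Real.sqrt_pos.2 Real.pi_pos
      have hG := Real.Gamma_pos_of_pos (show 0 < a + 1 / 2 by linarith)
      have h2 : (2 : ℝ) ^ (2 * a) * 2 ^ (1 - 2 * a) = 2 := by
        rw [← Real.rpow_add two_pos]; ring_nf; simp
      rw [show a - 1 / 2 + 1 = a + 1 / 2 by ring, ← div_eq_mul_inv, div_eq_div_iff hpi.ne' hG.ne',
        Real.Gamma_add_one (by linarith : 2 * a ≠ 0)]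
      linear_combination 2 ^ (2 * a) * a * dup + a * Real.Gamma (2 * a) * √Real.pi * h2
    rw [e]
    simp only [zero_mul, zero_add] at h
    refine h.congr' ?_
    filter_upwards [self_mem_nhdsWithin] with x hx
    have hx' : 0 < x := hx
    have e2 : (x : ℂ) ^ 2 = ((x ^ (1 + 2 * a) : ℝ) : ℂ) * ((x ^ (1 - 2 * a) : ℝ) : ℂ) := by
      rw [← Complex.ofReal_mul, ← Real.rpow_add hx', ← Complex.ofReal_pow]
      congr 1
      rw [← Real.rpow_natCast]
      congr 1
      push_cast; ring
    rw [← mul_assoc (((x ^ (1 + 2 * a) : ℝ) : ℂ)), ← e2]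

/-- The Wronskian of `J_a` with `I_ν`, `ν = 1/2 - a`. Here the factor `z^(2ν)` is needed for
constancy, and the `J_a` term is the one that survives at `0+`. -/
lemma cpow_mul_macdonaldIntegral_besselSeries_const {a : ℝ} (ha : 0 < a) (ha1 : a < 1 / 2) {z : ℂ}
    (hz : z ∈ Complex.slitPlane) :
    z ^ ((1 - 2 * a : ℝ) : ℂ) *
      (4 * a * macdonaldIntegral a z * besselSeries (-a - 1 / 2) (z ^ 2 / 4)
      + macdonaldIntegral (a + 1) z * besselSeries (1 / 2 - a) (z ^ 2 / 4)) =
    ((2 * Real.Gamma a * a / √Real.pi : ℝ) : ℂ) := by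
  have ha0 : (a : ℂ) ≠ 0 := by exact_mod_cast ha.ne'
  refine eqOn_slitPlane_of_deriv_eq_zero (f := fun z => z ^ ((1 - 2 * a : ℝ) : ℂ) *
      (4 * a * macdonaldIntegral a z * besselSeries (-a - 1 / 2) (z ^ 2 / 4)
      + macdonaldIntegral (a + 1) z * besselSeries (1 / 2 - a) (z ^ 2 / 4)))
    (fun z hz => ?_) ?_ hz
  · have hz0 := Complex.slitPlane_ne_zero hz
    have hp : HasDerivAt (fun z : ℂ => z ^ ((1 - 2 * a : ℝ) : ℂ))
        ((1 - 2 * a) * (z ^ ((1 - 2 * a : ℝ) : ℂ) / z)) z := by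
      refine ((hasDerivAt_id z).cpow_const (c := ((1 - 2 * a : ℝ) : ℂ)) hz).congr_deriv ?_
      simp only [id]
      rw [Complex.cpow_sub _ _ hz0, Complex.cpow_one]
      push_cast
      ring
    refine (hp.mul ((((hasDerivAt_macdonaldIntegral ha (by linarith) hz).const_mul
      (4 * a : ℂ)).mul (hasDerivAt_besselSeries_sq (-a - 1 / 2) z)).add
      ((hasDerivAt_macdonaldIntegral_succ ha (by linarith) hz).mul
      (hasDerivAt_besselSeries_sq (1 / 2 - a) z)))).congr_deriv ?_
    have r1 := besselSeries_recurrence (-a - 1 / 2) (z ^ 2 / 4)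
    rw [show -a - 1 / 2 + 1 = 1 / 2 - a by ring, show -a - 1 / 2 + 2 = 1 / 2 - a + 1 by ring] at r1
    rw [show -a - 1 / 2 + 1 = 1 / 2 - a by ring]
    push_cast at r1 ⊢
    simp only [Pi.add_apply, Pi.mul_apply]
    rw [r1]
    field_simp
    ring
  · have hx : Tendsto (fun x : ℝ => ((x ^ (1 - 2 * a) : ℝ) : ℂ)) (𝓝[>] 0) (𝓝 0) :=
      tendsto_ofReal_rpow_zero (by linarith)
    have h := (((tendsto_rpow_mul_macdonaldIntegral_zero ha ha1).const_mul (4 * a : ℂ)).mul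
      (tendsto_besselSeries_sq_zero (-a - 1 / 2))).add
      (hx.mul ((tendsto_macdonaldIntegral_succ_zero ha (by linarith)).mul
        (tendsto_besselSeries_sq_zero (1 / 2 - a))))
    have e : ((2 * Real.Gamma a * a / √Real.pi : ℝ) : ℂ) =
        4 * a * ((Real.Gamma a * Real.Gamma (1 / 2 - a) / (2 * √Real.pi) : ℝ) : ℂ) *
          ((Real.Gamma (-a - 1 / 2 + 1) : ℝ) : ℂ)⁻¹ := by
      have hpi : 0 < √Real.pi := Real.sqrt_pos.2 Real.pi_pos
      have hG := Real.Gamma_pos_of_pos (show 0 < 1 / 2 - a by linarith)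
      rw [show -a - 1 / 2 + 1 = 1 / 2 - a by ring]
      generalize Real.Gamma (1 / 2 - a) = G at hG
      norm_cast
      field_simp
      norm_num
    rw [e]
    simp only [zero_mul, add_zero] at h
    refine h.congr' ?_
    filter_upwards [self_mem_nhdsWithin] with x hx
    have hx' : 0 < x := hx
    rw [← Complex.ofReal_cpow hx'.le]
    ring

/-! ### Identification of `K_β` with the integral -/

lemma ofReal_mul_cpow {r : ℝ} (hr : 0 < r) {z : ℂ} (hz : z ≠ 0) (s : ℂ) :
    ((r : ℂ) * z) ^ s = (r : ℂ) ^ s * z ^ s := by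
  have hr' : (r : ℂ) ≠ 0 := by exact_mod_cast hr.ne'
  rw [Complex.cpow_def_of_ne_zero (mul_ne_zero hr' hz), Complex.cpow_def_of_ne_zero hr',
    Complex.cpow_def_of_ne_zero hz, ← Complex.exp_add, Complex.log_ofReal_mul hr hz,
    Complex.ofReal_log hr.le]
  ring_nf

lemma div_two_cpow_ofReal {z : ℂ} (hz : z ≠ 0) (s : ℝ) :
    (z / 2) ^ (s : ℂ) = (((2 : ℝ) ^ (-s) : ℝ) : ℂ) * z ^ (s : ℂ) := by
  have h := ofReal_mul_cpow (r := 2⁻¹) (by norm_num) hz (s : ℂ)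
  rw [← Complex.ofReal_cpow (by norm_num), Real.inv_rpow two_pos.le,
    ← Real.rpow_neg two_pos.le] at h
  rw [← h]
  congr 1
  push_cast
  ring

lemma besselKQuot_neg (ν : ℝ) (z : ℂ) : besselKQuot (-ν) z = besselKQuot ν z := by
  simp only [besselKQuot, neg_neg, neg_mul, Real.sin_neg, Complex.ofReal_neg]
  rw [div_neg, ← neg_div, neg_sub]

lemma besselKQuot_eq_macdonaldIntegral {a : ℝ} (ha : 0 < a) (ha1 : a < 1 / 2) {z : ℂ}
    (hz : z ∈ Complex.slitPlane) :
    besselKQuot (1 / 2 - a) z = ((√Real.pi * 2 ^ (1 / 2 - a) / Real.Gamma a : ℝ) : ℂ) *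
      z ^ ((1 / 2 - a : ℝ) : ℂ) * macdonaldIntegral a z := by
  have hz0 := Complex.slitPlane_ne_zero hz
  have hC := besselSeries_mul_sub_const (a := a) hz
  have hD := macdonaldIntegral_besselSeries_const ha ha1 hz
  have hE := cpow_mul_macdonaldIntegral_besselSeries_const ha ha1 hz
  have hcos : 0 < Real.cos (Real.pi * a) := by
    apply Real.cos_pos_of_mem_Ioo
    constructor <;> nlinarith [Real.pi_pos]
  have hG := Real.Gamma_pos_of_pos ha
  have hpi : 0 < √Real.pi := Real.sqrt_pos.2 Real.pi_pos
  have hs : Real.sin ((1 / 2 - a) * Real.pi) = Real.cos (Real.pi * a) := by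
    rw [show (1 / 2 - a) * Real.pi = Real.pi / 2 - Real.pi * a by ring, Real.sin_pi_div_two_sub]
  set p : ℂ := z ^ ((1 / 2 - a : ℝ) : ℂ) with hp
  have hp0 : p ≠ 0 := by rw [hp, Complex.cpow_ne_zero_iff]; exact Or.inl hz0
  have hp1 : z ^ ((1 - 2 * a : ℝ) : ℂ) = p * p := by
    rw [hp, ← Complex.cpow_add _ _ hz0]; push_cast; ring_nf
  have hp2 : z ^ ((-(1 / 2 - a) : ℝ) : ℂ) = p⁻¹ := by
    rw [Complex.ofReal_neg, Complex.cpow_neg]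
  set t : ℝ := 2 ^ (1 / 2 - a) with ht
  have ht0 : 0 < t := by positivity
  have ht1 : (2 : ℝ) ^ (2 * a) = 2 / (t * t) := by
    rw [eq_div_iff (by positivity), ht, ← Real.rpow_add two_pos, ← Real.rpow_add two_pos]
    ring_nf; simp
  have ht2 : (2 : ℝ) ^ (-(1 / 2 - a)) = t⁻¹ := Real.rpow_neg two_pos.le _
  rw [hp1] at hE
  rw [ht1] at hD
  rw [besselKQuot, besselI_eq, besselI_eq, div_two_cpow_ofReal hz0, div_two_cpow_ofReal hz0,
    ← hp, hp2, ht2, neg_neg, ← ht, hs, show -(1 / 2 - a) = a - 1 / 2 by ring]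
  have c1 : (Real.cos (Real.pi * a) : ℂ) ≠ 0 := by exact_mod_cast hcos.ne'
  have c2 : (Real.Gamma a : ℂ) ≠ 0 := by exact_mod_cast hG.ne'
  have c3 : (√Real.pi : ℂ) ≠ 0 := by exact_mod_cast hpi.ne'
  have c4 : (Real.pi : ℂ) ≠ 0 := by exact_mod_cast Real.pi_pos.ne'
  have c5 : (t : ℂ) ≠ 0 := by exact_mod_cast ht0.ne'
  have c6 : (a : ℂ) ≠ 0 := by exact_mod_cast ha.ne'
  have c7 : (√Real.pi : ℂ) * √Real.pi = Real.pi := by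
    exact_mod_cast Real.mul_self_sqrt Real.pi_pos.le
  rw [Complex.ofReal_cos] at c1
  push_cast at hC hD hE c1 ⊢
  -- What remains is algebra in these quantities, with `p = z^ν` and `t = 2^ν`.
  generalize macdonaldIntegral a z = A at *
  generalize macdonaldIntegral (a + 1) z = B at *
  generalize besselSeries (a + 1 / 2) (z ^ 2 / 4) = Sp at *
  generalize besselSeries (a - 1 / 2) (z ^ 2 / 4) = Sm at *
  generalize besselSeries (1 / 2 - a) (z ^ 2 / 4) = T at *
  generalize besselSeries (-a - 1 / 2) (z ^ 2 / 4) = U at *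
  generalize (Complex.cos (Real.pi * a)) = k at *
  generalize ((Real.Gamma a : ℝ) : ℂ) = G at *
  generalize (t : ℂ) = t at *
  generalize ((√Real.pi : ℝ) : ℂ) = R at *
  generalize (Real.pi : ℂ) = P at *
  subst c7
  -- The first two multiples cancel `B`, that is `J_{a+1}`; the third replaces the remaining
  -- coefficient of `A` by the constant Wronskian of `I_ν` and `I_{-ν}`.
  have key : 4 * a * A * (p * p) * (k / (R * R)) =
      2 * G * a / R * Sm - G * (2 / (t * t)) * a / R * (T * (p * p)) := by
    linear_combination Sm * hE - T * (p * p) * hD + 4 * a * A * (p * p) * hC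
  field_simp at key ⊢
  linear_combination (-1 / 2) * key

/-- Needed for `β = 0`, where `a = 1/2` is excluded from the Wronskian argument. For `1/4 < a < 1`
the power `u^(a-1)` is at most `u^(-3/4) + 1`, and `δ ≤ 1` bounds the other factor by `δ⁻¹`. -/
lemma tendsto_macdonaldIntegral_half {z : ℂ} (hz : z ∈ Complex.slitPlane) :
    Tendsto (fun a => macdonaldIntegral a z) (𝓝 (1 / 2)) (𝓝 (macdonaldIntegral (1 / 2) z)) := by
  obtain ⟨δ, hδ, hδ1, h⟩ := exists_ball_norm_two_mul_add_ge hz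
  refine Tendsto.const_mul _ ?_
  refine tendsto_integral_filter_of_dominated_convergence
    (fun u => (Real.exp (-u) * u ^ ((1 / 4 : ℝ) - 1) + Real.exp (-u) * u ^ ((1 : ℝ) - 1)) *
      δ ^ (-1 : ℝ)) ?_ ?_
    (((integrableOn_exp_mul_rpow (by norm_num)).add
      (integrableOn_exp_mul_rpow one_pos)).mul_const _) ?_
  · exact Eventually.of_forall fun a => aestronglyMeasurable_tricomi_integrand _ _ hz
  · filter_upwards [Ioo_mem_nhds (show (1 / 4 : ℝ) < 1 / 2 by norm_num)
      (show (1 / 2 : ℝ) < 1 by norm_num)] with a ha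
    filter_upwards [ae_restrict_mem measurableSet_Ioi] with u hu
    have hu' : 0 < u := hu
    rw [norm_mul, norm_exp_mul_rpow a hu', Complex.norm_cpow_real]
    have h1 := (h z (Metric.mem_ball_self hδ)).2 u hu'.le
    have h2 : ‖2 * z + u‖ ^ (a - 1) ≤ δ ^ (-1 : ℝ) :=
      (Real.rpow_le_rpow_of_nonpos hδ h1 (by linarith [ha.2])).trans
        (Real.rpow_le_rpow_of_exponent_ge hδ hδ1 (by linarith [ha.1]))
    have h3 : u ^ (a - 1) ≤ u ^ ((1 / 4 : ℝ) - 1) + u ^ ((1 : ℝ) - 1) := by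
      rcases le_total u 1 with hu1 | hu1
      · exact (Real.rpow_le_rpow_of_exponent_ge hu' hu1 (by linarith [ha.1])).trans
          (le_add_of_nonneg_right (by positivity))
      · exact (Real.rpow_le_rpow_of_exponent_le hu1 (by linarith [ha.2])).trans
          (le_add_of_nonneg_left (by positivity))
    rw [← mul_add]
    gcongr
  · filter_upwards [ae_restrict_mem measurableSet_Ioi] with u hu
    have hu' : 0 < u := hu
    have h0 := Complex.slitPlane_ne_zero (two_mul_add_mem_slitPlane hz hu'.le)
    refine Tendsto.mul ?_ ?_
    · refine (Complex.continuous_ofReal.tendsto _).comp (Tendsto.const_mul _ ?_)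
      have : Continuous fun a : ℝ => u ^ (a - 1) :=
        Continuous.rpow continuous_const (by fun_prop) (fun _ => Or.inl hu'.ne')
      exact this.tendsto _
    · have : Continuous fun a : ℝ => (2 * z + u) ^ ((a - 1 : ℝ) : ℂ) :=
        Continuous.const_cpow (by fun_prop) (Or.inl h0)
      exact this.tendsto _

/-- For `|β| < 1/2` the Macdonald function is an elementary factor times a Laplace-type integral. -/
lemma besselK_eq_macdonaldIntegral {β : ℝ} (hβ : |β| < 1 / 2) {z : ℂ}
    (hz : z ∈ Complex.slitPlane) :
    besselK β z = ((√Real.pi * 2 ^ |β| / Real.Gamma (1 / 2 - |β|) : ℝ) : ℂ) *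
      z ^ ((|β| : ℝ) : ℂ) * macdonaldIntegral (1 / 2 - |β|) z := by
  have quot : ∀ ν : ℝ, ν ≠ 0 → |ν| < 1 / 2 → besselKQuot ν z =
      ((√Real.pi * 2 ^ |ν| / Real.Gamma (1 / 2 - |ν|) : ℝ) : ℂ) *
      z ^ ((|ν| : ℝ) : ℂ) * macdonaldIntegral (1 / 2 - |ν|) z := by
    intro ν hν hν'
    have h := besselKQuot_eq_macdonaldIntegral (a := 1 / 2 - |ν|) (by linarith)
      (by linarith [abs_pos.2 hν]) hz
    rw [sub_sub_cancel] at h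
    rw [← h]
    -- The quotient is even in the order, so negative `ν` reduces to `|ν|`.
    rcases abs_choice ν with e | e <;> rw [e]
    rw [besselKQuot_neg]
  rcases eq_or_ne β 0 with rfl | h0
  · rw [besselK, if_pos ⟨0, by simp⟩]
    have habs : Tendsto (fun μ : ℝ => |μ|) (𝓝[≠] 0) (𝓝 0) := by
      simpa using (continuous_abs.tendsto (0 : ℝ)).mono_left (nhdsWithin_le_nhds (s := {0}ᶜ))
    have hsub : Tendsto (fun μ : ℝ => 1 / 2 - |μ|) (𝓝[≠] 0) (𝓝 (1 / 2)) := by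
      simpa only [sub_zero] using habs.const_sub (1 / 2)
    have hGam : ContinuousAt Real.Gamma (1 / 2) :=
      (Real.differentiableAt_Gamma fun m => by
        have : (0 : ℝ) ≤ m := m.cast_nonneg
        linarith).continuousAt
    have hG := Real.Gamma_pos_of_pos (show (0 : ℝ) < 1 / 2 by norm_num)
    have h1 : Tendsto (fun μ : ℝ => √Real.pi * 2 ^ |μ| / Real.Gamma (1 / 2 - |μ|)) (𝓝[≠] 0)
        (𝓝 (√Real.pi * 2 ^ (0 : ℝ) / Real.Gamma (1 / 2))) :=
      Tendsto.div ((tendsto_const_nhds.rpow habs (Or.inl two_ne_zero)).const_mul _)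
        (hGam.tendsto.comp hsub) hG.ne'
    have h2 : Tendsto (fun μ : ℝ => z ^ ((|μ| : ℝ) : ℂ)) (𝓝[≠] 0) (𝓝 (z ^ ((0 : ℝ) : ℂ))) := by
      have : Continuous fun s : ℝ => z ^ (s : ℂ) :=
        Continuous.const_cpow (by fun_prop) (Or.inl (Complex.slitPlane_ne_zero hz))
      exact (this.tendsto 0).comp habs
    have h3 := (tendsto_macdonaldIntegral_half hz).comp hsub
    have h4 := ((((Complex.continuous_ofReal.tendsto _).comp h1).mul h2).mul h3)
    rw [abs_zero, sub_zero]
    refine (h4.congr' ?_).limUnder_eq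
    have hlt : ∀ᶠ μ : ℝ in 𝓝[≠] 0, |μ| < 1 / 2 := habs.eventually_lt_const (by norm_num)
    filter_upwards [hlt, self_mem_nhdsWithin] with μ hμ hμ0
    exact (quot μ hμ0 hμ).symm
  · rw [besselK, if_neg, quot β h0 hβ]
    rintro ⟨n, rfl⟩
    have h1 : |n| < 1 := by
      have : |(n : ℝ)| < 1 := by linarith
      exact_mod_cast this
    exact h0 (by exact_mod_cast Int.abs_lt_one_iff.1 h1)

/-! ### Sign of the imaginary part off the real axis -/

lemma setIntegral_Ioi_pos {g : ℝ → ℝ} (hg : IntegrableOn g (Ioi 0)) (h : ∀ u > 0, 0 < g u) :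
    0 < ∫ u in Ioi (0 : ℝ), g u := by
  rw [setIntegral_pos_iff_support_of_nonneg_ae _ hg]
  · have : Function.support g ∩ Ioi 0 = Ioi 0 :=
      inter_eq_right.2 fun u hu => (h u hu).ne'
    rw [this]
    simp
  · filter_upwards [ae_restrict_mem measurableSet_Ioi] with u hu
    exact (h u hu).le

lemma cpow_mul_cpow_im_eq {z w : ℂ} (hz : z ≠ 0) (hw : w ≠ 0) (s t : ℝ) :
    (z ^ (s : ℂ) * w ^ (t : ℂ)).im =
      Real.exp (s * Real.log ‖z‖ + t * Real.log ‖w‖) * Real.sin (s * z.arg + t * w.arg) := by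
  rw [Complex.cpow_def_of_ne_zero hz, Complex.cpow_def_of_ne_zero hw, ← Complex.exp_add,
    Complex.exp_im]
  simp only [Complex.add_re, Complex.add_im, Complex.mul_re, Complex.mul_im, Complex.log_re,
    Complex.log_im, Complex.ofReal_re, Complex.ofReal_im, mul_zero, sub_zero, zero_add]
  ring_nf

/-- The angle `-a arg z + (a-1) arg w` is minus a convex combination of two arguments of the same
sign in `(-π, π)`, so its sine has the sign opposite to `Im z`. -/
lemma im_mul_cpow_mul_cpow_im_neg {a : ℝ} (ha : 0 < a) (ha1 : a < 1) {z w : ℂ} (hz : z.im ≠ 0)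
    (hw : 0 < z.im * w.im) :
    z.im * (z ^ ((-a : ℝ) : ℂ) * w ^ ((a - 1 : ℝ) : ℂ)).im < 0 := by
  have hw' : w.im ≠ 0 := (mul_ne_zero_iff.1 hw.ne').2
  have hz0 : z ≠ 0 := by rintro rfl; simp at hz
  have hw0 : w ≠ 0 := by rintro rfl; simp at hw'
  rw [cpow_mul_cpow_im_eq hz0 hw0]
  have hE := Real.exp_pos (-a * Real.log ‖z‖ + (a - 1) * Real.log ‖w‖)
  have hz1 : z.arg < Real.pi := Complex.arg_lt_pi_iff.2 (Or.inr hz)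
  have hw1 : w.arg < Real.pi := Complex.arg_lt_pi_iff.2 (Or.inr hw')
  rcases hz.lt_or_gt with h | h
  · have h' : w.im < 0 := by
      by_contra! h2
      nlinarith
    have hz2 := Complex.arg_neg_iff.2 h
    have hw2 := Complex.arg_neg_iff.2 h'
    have hz3 := Complex.neg_pi_lt_arg z
    have hw3 := Complex.neg_pi_lt_arg w
    have : 0 < Real.sin (-a * z.arg + (a - 1) * w.arg) := by
      apply Real.sin_pos_of_pos_of_lt_pi <;> nlinarith
    exact mul_neg_of_neg_of_pos h (mul_pos hE this)
  · have h' : 0 < w.im := pos_of_mul_pos_right hw h.le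
    have hz2 : 0 < z.arg := lt_of_le_of_ne (Complex.arg_nonneg_iff.2 h.le)
      fun e => hz (Complex.arg_eq_zero_iff.1 e.symm).2
    have hw2 : 0 < w.arg := lt_of_le_of_ne (Complex.arg_nonneg_iff.2 h'.le)
      fun e => hw' (Complex.arg_eq_zero_iff.1 e.symm).2
    have : Real.sin (-a * z.arg + (a - 1) * w.arg) < 0 := by
      apply Real.sin_neg_of_neg_of_neg_pi_lt <;> nlinarith
    exact mul_neg_of_pos_of_neg h (mul_neg_of_pos_of_neg hE this)

/-- The pointwise inequality with `w = 2z + u`, integrated against the positive weight `e^(-u)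
u^(a-1)`. -/
lemma im_mul_cpow_mul_tricomiIntegral_im_neg {a : ℝ} (ha : 0 < a) (ha1 : a < 1) {z : ℂ}
    (hz : z.im ≠ 0) :
    z.im * (z ^ ((-a : ℝ) : ℂ) * tricomiIntegral a (a - 1) z).im < 0 := by
  have hzs : z ∈ Complex.slitPlane := Complex.mem_slitPlane_iff.2 (Or.inr hz)
  have hi := (integrableOn_tricomi_integrand (q := a - 1) ha (by linarith) hzs).const_mul
    (z ^ ((-a : ℝ) : ℂ))
  rw [tricomiIntegral, ← integral_const_mul]
  have him := integral_im hi
  simp only [RCLike.im_to_complex] at him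
  rw [← him, ← integral_const_mul, ← neg_pos, ← integral_neg]
  refine setIntegral_Ioi_pos ((hi.im.const_mul _).neg) fun u hu => ?_
  have hw : 0 < z.im * (2 * z + u).im := by
    have : (2 * z + u).im = 2 * z.im := by simp
    rw [this]
    have := mul_self_pos.2 hz
    linarith
  have key := im_mul_cpow_mul_cpow_im_neg ha ha1 hz hw
  have hw0 : 0 < Real.exp (-u) * u ^ (a - 1) := by positivity
  rw [mul_left_comm, Complex.im_ofReal_mul, neg_pos, mul_left_comm]
  exact mul_neg_of_pos_of_neg hw0 key

/-! ### The positive real axis -/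

/-- The integral `∫₀^∞ e^{-u} u^{a-1} (2x+u)^{a-1} du` on the real axis. -/
noncomputable def realTricomiIntegral (a x : ℝ) : ℝ :=
  ∫ u in Ioi (0 : ℝ), Real.exp (-u) * u ^ (a - 1) * (2 * x + u) ^ (a - 1)

lemma integrableOn_realTricomi_integrand {a : ℝ} (ha : 0 < a) (ha1 : a < 1) {x : ℝ} (hx : 0 < x) :
    IntegrableOn (fun u : ℝ => Real.exp (-u) * u ^ (a - 1) * (2 * x + u) ^ (a - 1)) (Ioi 0) := by
  have hi := (integrableOn_tricomi_integrand (q := a - 1) ha (by linarith)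
    (Complex.ofReal_mem_slitPlane.2 hx)).re
  refine IntegrableOn.congr_fun hi (fun u hu => ?_) measurableSet_Ioi
  have hu' : 0 < u := hu
  have e : (2 * x + u : ℂ) ^ ((a - 1 : ℝ) : ℂ) = (((2 * x + u) ^ (a - 1) : ℝ) : ℂ) := by
    rw [Complex.ofReal_cpow (by positivity)]
    push_cast
    rfl
  simp only [e, ← Complex.ofReal_mul]
  rfl

lemma realTricomiIntegral_pos {a : ℝ} (ha : 0 < a) (ha1 : a < 1) {x : ℝ} (hx : 0 < x) :
    0 < realTricomiIntegral a x :=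
  setIntegral_Ioi_pos (integrableOn_realTricomi_integrand ha ha1 hx) fun u hu => by
    have hu' : 0 < u := hu
    positivity

lemma realTricomiIntegral_anti {a : ℝ} (ha : 0 < a) (ha1 : a < 1) {x y : ℝ} (hx : 0 < x)
    (hxy : x ≤ y) : realTricomiIntegral a y ≤ realTricomiIntegral a x := by
  refine setIntegral_mono_on (integrableOn_realTricomi_integrand ha ha1 (hx.trans_le hxy))
    (integrableOn_realTricomi_integrand ha ha1 hx) measurableSet_Ioi fun u hu => ?_
  have hu' : 0 < u := hu
  gcongr ?_ * ?_
  exact Real.rpow_le_rpow_of_nonpos (by positivity) (by linarith) (by linarith)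

lemma cpow_mul_tricomiIntegral_ofReal (a : ℝ) {x : ℝ} (hx : 0 < x) :
    (x : ℂ) ^ ((-a : ℝ) : ℂ) * tricomiIntegral a (a - 1) x =
      ((x ^ (-a) * realTricomiIntegral a x : ℝ) : ℂ) := by
  rw [tricomiIntegral_ofReal _ _ hx, Complex.ofReal_mul, Complex.ofReal_cpow hx.le]
  rfl

lemma strictAntiOn_rpow_mul_realTricomiIntegral {a : ℝ} (ha : 0 < a) (ha1 : a < 1) :
    StrictAntiOn (fun x => x ^ (-a) * realTricomiIntegral a x) (Ioi 0) := by
  intro x hx y hy hxy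
  have hx' : 0 < x := hx
  have hy' : 0 < y := hy
  exact mul_lt_mul (Real.rpow_lt_rpow_of_neg hx' hxy (by linarith))
    (realTricomiIntegral_anti ha ha1 hx' hxy.le) (realTricomiIntegral_pos ha ha1 hy')
    (by positivity)

lemma continuousOn_rpow_mul_realTricomiIntegral {a : ℝ} (ha : 0 < a) (ha1 : a < 1) :
    ContinuousOn (fun x => x ^ (-a) * realTricomiIntegral a x) (Ioi 0) := by
  refine ContinuousOn.mul (fun x hx => ?_) (fun x hx => ?_)
  · exact (Real.continuousAt_rpow_const x _ (Or.inl (mem_Ioi.1 hx).ne')).continuousWithinAt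
  · have h := (hasDerivAt_tricomiIntegral (q := a - 1) ha (by linarith)
      (Complex.ofReal_mem_slitPlane.2 (mem_Ioi.1 hx))).continuousAt
    have h2 : ContinuousAt (fun x : ℝ => (tricomiIntegral a (a - 1) x).re) x :=
      Complex.continuous_re.continuousAt.comp
        (ContinuousAt.comp (f := fun x : ℝ => (x : ℂ)) h Complex.continuous_ofReal.continuousAt)
    refine h2.continuousWithinAt.congr (fun y hy => ?_) ?_
    · rw [tricomiIntegral_ofReal _ _ (mem_Ioi.1 hy)]; rfl
    · rw [tricomiIntegral_ofReal _ _ (mem_Ioi.1 hx)]; rfl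

/-- The factor `e^z` cancels the `e^(-z)` in `macdonaldIntegral`, and the powers combine to the
exponent `-1/2 + |β|`. -/
lemma exists_scaled_besselK_eq {β : ℝ} (hβ : |β| < 1 / 2) : ∃ κ : ℝ, 0 < κ ∧
    ∀ z ∈ Complex.slitPlane,
      (2 * (Real.pi : ℂ) * z) ^ (-(1 / 2) : ℂ) * Complex.exp z * besselK β z =
        κ * (z ^ ((-(1 / 2 - |β|) : ℝ) : ℂ) *
          tricomiIntegral (1 / 2 - |β|) (1 / 2 - |β| - 1) z) := by
  have hG := Real.Gamma_pos_of_pos (show 0 < 1 / 2 - |β| by linarith)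
  have hpi := Real.pi_pos
  refine ⟨(2 * Real.pi) ^ (-(1 / 2) : ℝ) * (√Real.pi * 2 ^ |β| / Real.Gamma (1 / 2 - |β|)),
    by positivity, fun z hz => ?_⟩
  have hz0 := Complex.slitPlane_ne_zero hz
  have e1 : (2 * (Real.pi : ℂ) * z) ^ (-(1 / 2) : ℂ) =
      (((2 * Real.pi) ^ (-(1 / 2) : ℝ) : ℝ) : ℂ) * z ^ (-(1 / 2) : ℂ) := by
    have := ofReal_mul_cpow (r := 2 * Real.pi) (by positivity) hz0 (-(1 / 2))
    rw [Complex.ofReal_cpow (by positivity)]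
    push_cast at this ⊢
    exact this
  have e2 : z ^ ((-(1 / 2 - |β|) : ℝ) : ℂ) = z ^ (-(1 / 2) : ℂ) * z ^ ((|β| : ℝ) : ℂ) := by
    rw [← Complex.cpow_add _ _ hz0]
    push_cast
    ring_nf
  have e3 : Complex.exp z * Complex.exp (-z) = 1 := by rw [← Complex.exp_add]; simp
  rw [e1, e2, besselK_eq_macdonaldIntegral hβ hz, macdonaldIntegral, Complex.ofReal_mul]
  linear_combination (((2 * Real.pi) ^ (-(1 / 2) : ℝ) : ℝ) : ℂ) * z ^ (-(1 / 2) : ℂ) *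
    ((√Real.pi * 2 ^ |β| / Real.Gamma (1 / 2 - |β|) : ℝ) : ℂ) * z ^ ((|β| : ℝ) : ℂ) *
    tricomiIntegral (1 / 2 - |β|) (1 / 2 - |β| - 1) z * e3

/-- Intermediate value theorem. By monotonicity the integral is at least `R` for `x ≤ 1` and at most
`R` for `x ≥ 1`, so `x^(-a)` alone decides both ends. -/
lemma exists_pos_root {a κ b c : ℝ} (ha : 0 < a) (ha1 : a < 1) (hκ : 0 < κ)
    (hb : 0 < b ∨ b = 0 ∧ 0 < c) :
    ∃ x : ℝ, 0 < x ∧ κ * (x ^ (-a) * realTricomiIntegral a x) = b * x + c := by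
  have hR := realTricomiIntegral_pos ha ha1 one_pos
  set R := realTricomiIntegral a 1
  have hb0 : 0 ≤ b := by rcases hb with h | h; exacts [h.le, h.1.ge]
  obtain ⟨x₁, hx₁, hx₁', hlo⟩ : ∃ x : ℝ, 0 < x ∧ x ≤ 1 ∧
      b * x + c ≤ κ * (x ^ (-a) * realTricomiIntegral a x) := by
    -- The witness `M^(-1/a)` satisfies `x^(-a) = M`; `M ≥ 1` keeps it in `(0, 1]`, and `M κ R ≥ b +
    -- c` beats the line there.
    set M : ℝ := max 1 ((b + c) / (κ * R))
    have hM : 1 ≤ M := le_max_left _ _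
    have hM0 : 0 < M := one_pos.trans_le hM
    have hx1 : M ^ (-(1 / a)) ≤ 1 :=
      Real.rpow_le_one_of_one_le_of_nonpos hM (by simpa using ha.le)
    refine ⟨M ^ (-(1 / a)), by positivity, hx1, ?_⟩
    have hpow : (M ^ (-(1 / a))) ^ (-a) = M := by
      rw [← Real.rpow_mul hM0.le]
      have : -(1 / a) * -a = 1 := by field_simp
      rw [this, Real.rpow_one]
    rw [hpow]
    calc b * M ^ (-(1 / a)) + c ≤ b * 1 + c := by gcongr
      _ = (b + c) / (κ * R) * (κ * R) := by field_simp
      _ ≤ M * (κ * R) := by gcongr; exact le_max_right _ _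
      _ = κ * (M * R) := by ring
      _ ≤ _ := by
        gcongr
        exact realTricomiIntegral_anti ha ha1 (by positivity) hx1
  obtain ⟨x₂, hx₂, hhi⟩ : ∃ x : ℝ, 1 ≤ x ∧
      κ * (x ^ (-a) * realTricomiIntegral a x) ≤ b * x + c := by
    have hlim : Tendsto (fun x : ℝ => κ * (x ^ (-a) * R)) atTop (𝓝 0) := by
      simpa using ((tendsto_rpow_neg_atTop ha).mul_const R).const_mul κ
    have hev : ∀ᶠ x : ℝ in atTop, κ * (x ^ (-a) * R) ≤ b * x + c := by
      rcases hb with h | ⟨rfl, h⟩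
      · have h1 : Tendsto (fun x : ℝ => b * x + c) atTop atTop :=
          tendsto_atTop_add_const_right _ _ (tendsto_id.const_mul_atTop h)
        filter_upwards [hlim.eventually_le_const one_pos, h1.eventually_ge_atTop 1] with x h2 h3
        exact h2.trans h3
      · filter_upwards [hlim.eventually_le_const h] with x h2
        simpa using h2
    obtain ⟨x, hx, hx1⟩ := (hev.and (eventually_ge_atTop 1)).exists
    refine ⟨x, hx1, le_trans ?_ hx⟩
    gcongr
    exact realTricomiIntegral_anti ha ha1 one_pos hx1
  have hcont : ContinuousOn
      (fun x => κ * (x ^ (-a) * realTricomiIntegral a x) - (b * x + c)) (Icc x₁ x₂) :=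
    ((continuousOn_const.mul (continuousOn_rpow_mul_realTricomiIntegral ha ha1)).sub
      (by fun_prop)).mono fun y hy => hx₁.trans_le hy.1
  obtain ⟨x, hx, hx0⟩ := intermediate_value_Icc' (hx₁'.trans hx₂) hcont
    (show (0 : ℝ) ∈ Icc _ _ from ⟨by linarith, by linarith⟩)
  exact ⟨x, hx₁.trans_le hx.1, sub_eq_zero.1 hx0⟩

theorem mainTheorem9 (β b c : ℝ) (hβ : -(1 / 2) < β) (hβ' : β < 1 / 2) (hb : 0 ≤ b) :
    ((0 < b ∨ (b = 0 ∧ 0 < c)) →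
      ∃ x : ℝ, 0 < x ∧
        {z : ℂ | z ∈ Complex.slitPlane ∧
          (2 * (Real.pi : ℂ) * z) ^ (-(1 / 2) : ℂ) * Complex.exp z * besselK β z
            - (b : ℂ) * z - (c : ℂ) = 0} = {(x : ℂ)}) ∧
    (¬ (0 < b ∨ (b = 0 ∧ 0 < c)) →
      ∀ z ∈ Complex.slitPlane,
        (2 * (Real.pi : ℂ) * z) ^ (-(1 / 2) : ℂ) * Complex.exp z * besselK β z
          - (b : ℂ) * z - (c : ℂ) ≠ 0) ∧
    (∀ z ∈ Complex.slitPlane, besselK β z ≠ 0) := by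
  have hβa : |β| < 1 / 2 := abs_lt.2 ⟨hβ, hβ'⟩
  obtain ⟨κ, hκ, hF⟩ := exists_scaled_besselK_eq hβa
  set a := 1 / 2 - |β|
  have ha : 0 < a := by simp only [a]; linarith
  have ha1 : a < 1 := by simp only [a]; linarith [abs_nonneg β]
  have hreal : ∀ x : ℝ, 0 < x →
      (2 * (Real.pi : ℂ) * x) ^ (-(1 / 2) : ℂ) * Complex.exp x * besselK β x =
        ((κ * (x ^ (-a) * realTricomiIntegral a x) : ℝ) : ℂ) := fun x hx => by
    rw [hF x (Complex.ofReal_mem_slitPlane.2 hx), cpow_mul_tricomiIntegral_ofReal a hx,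
      Complex.ofReal_mul κ]
  -- Stated for arbitrary coefficients, since nonvanishing of `K_β` uses it with `b = c = 0`.
  have hroot : ∀ b c : ℝ, 0 ≤ b → ∀ z ∈ Complex.slitPlane,
      (2 * (Real.pi : ℂ) * z) ^ (-(1 / 2) : ℂ) * Complex.exp z * besselK β z
        - (b : ℂ) * z - (c : ℂ) = 0 →
      ∃ x : ℝ, 0 < x ∧ z = x ∧ κ * (x ^ (-a) * realTricomiIntegral a x) = b * x + c := by
    intro b c hb z hz hz0
    have him : z.im = 0 := by
      by_contra him
      have h1 := im_mul_cpow_mul_tricomiIntegral_im_neg ha ha1 him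
      rw [hF z hz] at hz0
      have h2 := congrArg Complex.im hz0
      simp only [Complex.sub_im, Complex.im_ofReal_mul, Complex.ofReal_im, Complex.zero_im] at h2
      have h3 : 0 ≤ b * (z.im * z.im) := mul_nonneg hb (mul_self_nonneg _)
      have h4 := mul_neg_of_pos_of_neg hκ h1
      -- The imaginary part of the equation times `Im z`: the left side is negative, the right side
      -- nonnegative.
      have h5 : κ * (z.im * (z ^ ((-a : ℝ) : ℂ) * tricomiIntegral a (a - 1) z).im) =
          b * (z.im * z.im) := by linear_combination z.im * h2
      linarith
    obtain ⟨x, rfl⟩ : ∃ x : ℝ, z = x := ⟨z.re, Complex.ext (by simp) (by simpa using him)⟩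
    have hx := Complex.ofReal_mem_slitPlane.1 hz
    refine ⟨x, hx, rfl, ?_⟩
    rw [hreal x hx] at hz0
    have : κ * (x ^ (-a) * realTricomiIntegral a x) - b * x - c = 0 := by exact_mod_cast hz0
    linarith
  have hpos : ∀ x : ℝ, 0 < x → 0 < κ * (x ^ (-a) * realTricomiIntegral a x) := fun x hx => by
    have := realTricomiIntegral_pos ha ha1 hx
    positivity
  refine ⟨fun h => ?_, fun h z hz hz0 => ?_, fun z hz hz0 => ?_⟩
  · obtain ⟨x, hx, hx0⟩ := exists_pos_root ha ha1 hκ h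
    refine ⟨x, hx, Set.eq_singleton_iff_unique_mem.2
      ⟨⟨Complex.ofReal_mem_slitPlane.2 hx, ?_⟩, ?_⟩⟩
    · rw [hreal x hx, hx0]
      push_cast
      ring
    · rintro z ⟨hz, hz0⟩
      obtain ⟨y, hy, rfl, hy0⟩ := hroot b c hb z hz hz0
      congr 1
      -- A strictly decreasing function meets the nondecreasing `b x + c` at most once.
      have hanti := strictAntiOn_rpow_mul_realTricomiIntegral ha ha1
      rcases lt_trichotomy x y with hxy | hxy | hxy
      · have := mul_lt_mul_of_pos_left (hanti hx hy hxy) hκ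
        have := mul_le_mul_of_nonneg_left hxy.le hb
        simp only at *
        linarith
      · exact hxy.symm
      · have := mul_lt_mul_of_pos_left (hanti hy hx hxy) hκ
        have := mul_le_mul_of_nonneg_left hxy.le hb
        simp only at *
        linarith
  · obtain ⟨x, hx, -, hx0⟩ := hroot b c hb z hz hz0
    obtain ⟨hb1, hc⟩ := not_or.1 h
    have hb0 : b = 0 := le_antisymm (not_lt.1 hb1) hb
    have hc0 : c ≤ 0 := not_lt.1 fun hc' => hc ⟨hb0, hc'⟩
    have := hpos x hx
    rw [hx0, hb0] at this
    linarith
  · obtain ⟨x, hx, -, hx0⟩ := hroot 0 0 le_rfl z hz (by rw [hz0]; simp)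
    have := hpos x hx
    rw [hx0] at this
    simp at this
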